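/- Conventions. Let $M$ be a connected (Hausdorff, second countable) $C^\infty$ manifold of dimension $3$. A paracontact metric structure $(\varphi,\xi,\eta,g)$ on $M$ consists of a smooth $(1,1)$-tensor field $\varphi$, a smooth vector field $\xi$, a smooth one-form $\eta$ with $\eta\wedge d\eta\neq 0$ everywhere, and a smooth pseudo-Riemannian metric $g$ such that $\eta(\xi)=1$, $d\eta(\xi,X)=0$, $$d\eta(X,Y)=g(X,\varphi Y),\qquad \eta(X)=g(X,\xi),\qquad \varphi^2=\mathrm{Id}-\eta\otimes\xi,$$ where $d\eta(X,Y)=\tfrac12\big(X\eta(Y)-Y\eta(X)-\eta([X,Y])\big)$. Let $\nabla$ be the Levi-Civita connection of $g$, $R(X,Y)Z=\nabla_X\nabla_YZ-\nabla_Y\nabla_XZ-\nabla_{[X,Y]}Z$ its curvature tensor, $\mathrm{Ric}(Y,Z)=\mathrm{tr}\,(X\mapsto R(X,Y)Z)$, $Q$ the Ricci operator, given by $g(QY,Z)=\mathrm{Ric}(Y,Z)$, and $\mathrm{scal}=\mathrm{tr}\,Q$. Put $lX=R(X,\xi)\xi$ and $h=\tfrac12\mathcal L_\xi\varphi$. For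 vectors $X,Y$ spanning a nondegenerate plane let $K(X,Y)=\dfrac{g(R(X,Y)Y,X)}{g(X,X)g(Y,Y)-g(X,Y)^2}$. For $X\perp\xi$ with $g(X,X)\ne0$, $K(\xi,X)$ is called a $\xi$-sectional curvature and $K(X,\varphi X)$ a $\varphi$-sectional curvature. Theorem. Let $M$ be a connected $3$-dimensional manifold with a paracontact metric structure $(\varphi,\xi,\eta,g)$ such that $Q\varphi=\varphi Q$. Then the function $\mathrm{tr}\,l$ is constant on $M$, say $\mathrm{tr}\,l=2k$ with $k\in\mathbb R$, and one of the following holds: 1. $k=-1$ and $\mathrm{tr}\,h^2=0$ everywhere on $M$; 2. $k=0$ and $M$ is flat, that is, $R=0$ everywhere; 3. $k\neq-1$, $k\neq 0$, all $\xi$-sectional curvatures of $M$ are equal to $k$ (so $k\neq -1$), all $\varphi$-sectional curvatures of $M$ are equal to $-k$ (so $-k\neq 1$), and $\mathrm{scal}=2k$ everywhere on $M$. -/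

import Mathlib

open scoped Manifold ContDiff
open Bundle VectorField

noncomputable section

namespace Paracontact

section Metric

variable {E : Type*} [NormedAddCommGroup E] [NormedSpace ℝ E]
  {M : Type*} [TopologicalSpace M] [ChartedSpace E M]

/-- The derivative `X f` of a function `f` along a vector field `X`, at the point `x`. -/
def dirDeriv (X : ∀ x : M, TangentSpace 𝓘(ℝ, E) x) (f : M → ℝ) (x : M) : ℝ :=
  mvfderiv 𝓘(ℝ, E) f x (X x)

lemma dirDeriv_add (X : ∀ x : M, TangentSpace 𝓘(ℝ, E) x) {f f' : M → ℝ} {x : M}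
    (hf : MDifferentiableAt 𝓘(ℝ, E) 𝓘(ℝ, ℝ) f x) (hf' : MDifferentiableAt 𝓘(ℝ, E) 𝓘(ℝ, ℝ) f' x) :
    dirDeriv X (f + f') x = dirDeriv X f x + dirDeriv X f' x := by
  simp [dirDeriv, mvfderiv_add hf hf']

lemma dirDeriv_mul (X : ∀ x : M, TangentSpace 𝓘(ℝ, E) x) {f f' : M → ℝ} {x : M}
    (hf : MDifferentiableAt 𝓘(ℝ, E) 𝓘(ℝ, ℝ) f x) (hf' : MDifferentiableAt 𝓘(ℝ, E) 𝓘(ℝ, ℝ) f' x) :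
    dirDeriv X (f * f') x = f x * dirDeriv X f' x + dirDeriv X f x * f' x := by
  simp [dirDeriv, mvfderiv_mul hf hf']
  ring

lemma dirDeriv_add_left (X Y : ∀ x : M, TangentSpace 𝓘(ℝ, E) x) (f : M → ℝ) (x : M) :
    dirDeriv (X + Y) f x = dirDeriv X f x + dirDeriv Y f x := by
  simp [dirDeriv]

lemma dirDeriv_smul_left (a : M → ℝ) (X : ∀ x : M, TangentSpace 𝓘(ℝ, E) x) (f : M → ℝ) (x : M) :
    dirDeriv (a • X) f x = a x * dirDeriv X f x := by
  simp [dirDeriv]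

/-- The exterior derivative of a one-form `η`, with the normalisation
`dη(X, Y) = (X(η(Y)) - Y(η(X)) - η([X, Y])) / 2`. -/
def extDeriv (η : ∀ x : M, TangentSpace 𝓘(ℝ, E) x →L[ℝ] ℝ)
    (X Y : ∀ x : M, TangentSpace 𝓘(ℝ, E) x) (x : M) : ℝ :=
  (1 / 2) * (dirDeriv X (fun y ↦ η y (Y y)) x - dirDeriv Y (fun y ↦ η y (X y)) x
    - η x (mlieBracket 𝓘(ℝ, E) X Y x))

variable [IsManifold 𝓘(ℝ, E) ∞ M]

/-- The vector field `X` is differentiable at `x`. -/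
abbrev DiffAt (X : ∀ x : M, TangentSpace 𝓘(ℝ, E) x) (x : M) : Prop := MDiffAt (T% X) x

variable (E M) in
/-- A smooth pseudo-Riemannian metric (of arbitrary signature) on the manifold `M`. -/
structure PseudoRiemannianMetric where
  inner (x : M) : TangentSpace 𝓘(ℝ, E) x →L[ℝ] TangentSpace 𝓘(ℝ, E) x →L[ℝ] ℝ
  symm (x : M) (v w : TangentSpace 𝓘(ℝ, E) x) : inner x v w = inner x w v
  nondegenerate (x : M) (v : TangentSpace 𝓘(ℝ, E) x) (hv : ∀ w, inner x v w = 0) : v = 0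
  contMDiff : ContMDiff 𝓘(ℝ, E) (𝓘(ℝ, E).prod 𝓘(ℝ, E →L[ℝ] E →L[ℝ] ℝ)) ∞
    (fun x ↦ TotalSpace.mk' (E →L[ℝ] E →L[ℝ] ℝ)
      (E := fun x : M ↦ TangentSpace 𝓘(ℝ, E) x →L[ℝ] TangentSpace 𝓘(ℝ, E) x →L[ℝ] ℝ) x (inner x))

instance [FiniteDimensional ℝ E] (x : M) : FiniteDimensional ℝ (TangentSpace 𝓘(ℝ, E) x) :=
  inferInstanceAs (FiniteDimensional ℝ E)

instance (x : M) : T2Space (TangentSpace 𝓘(ℝ, E) x) :=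
  inferInstanceAs (T2Space E)

namespace PseudoRiemannianMetric

variable (g : PseudoRiemannianMetric E M)

/-- The function `g(X, Y)`. -/
def fn (X Y : ∀ x : M, TangentSpace 𝓘(ℝ, E) x) (y : M) : ℝ := g.inner y (X y) (Y y)

/-- The right-hand side of Koszul's formula for `g(∇_X Y, Z)`. -/
def koszul (X Y Z : ∀ x : M, TangentSpace 𝓘(ℝ, E) x) (x : M) : ℝ :=
  (1 / 2) * (dirDeriv X (g.fn Y Z) x + dirDeriv Y (g.fn Z X) x - dirDeriv Z (g.fn X Y) x
    + g.inner x (mlieBracket 𝓘(ℝ, E) X Y x) (Z x)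
    - g.inner x (mlieBracket 𝓘(ℝ, E) Y Z x) (X x)
    + g.inner x (mlieBracket 𝓘(ℝ, E) Z X x) (Y x))

variable {g} {X X' Y Y' Z Z' : ∀ x : M, TangentSpace 𝓘(ℝ, E) x} {x : M}

lemma mdifferentiableAt_fn (hX : DiffAt X x) (hY : DiffAt Y x) :
    MDifferentiableAt 𝓘(ℝ, E) 𝓘(ℝ, ℝ) (g.fn X Y) x := by
  have h : MDifferentiableAt 𝓘(ℝ, E) (𝓘(ℝ, E).prod 𝓘(ℝ, ℝ))
      (fun m ↦ TotalSpace.mk' ℝ (E := Bundle.Trivial M ℝ) m (g.inner m (X m) (Y m))) x := by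
    apply MDifferentiableAt.clm_bundle_apply₂ (F₁ := E) (F₂ := E)
    · exact (g.contMDiff x).mdifferentiableAt (by simp)
    · exact hX
    · exact hY
  simp only [mdifferentiableAt_totalSpace] at h
  exact h.2

lemma fn_add_left : g.fn (X + X') Y = g.fn X Y + g.fn X' Y := by
  ext y; simp [fn]

lemma fn_add_right : g.fn X (Y + Y') = g.fn X Y + g.fn X Y' := by
  ext y; simp [fn]

lemma fn_smul_left (a : M → ℝ) : g.fn (a • X) Y = a * g.fn X Y := by
  ext y; simp [fn]

lemma fn_smul_right (a : M → ℝ) : g.fn X (a • Y) = a * g.fn X Y := by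
  ext y; simp [fn]

variable (g) in
lemma eq_of_inner_eq {v w : TangentSpace 𝓘(ℝ, E) x}
    (h : ∀ u, g.inner x v u = g.inner x w u) : v = w :=
  sub_eq_zero.1 (g.nondegenerate x _ fun u ↦ by simp [h])

variable [FiniteDimensional ℝ E]

lemma koszul_add_left (hX : DiffAt X x) (hX' : DiffAt X' x) (hY : DiffAt Y x) (hZ : DiffAt Z x) :
    g.koszul (X + X') Y Z x = g.koszul X Y Z x + g.koszul X' Y Z x := by
  have : CompleteSpace E := FiniteDimensional.complete ℝ E
  simp only [koszul, fn_add_left, fn_add_right, dirDeriv_add_left,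
    dirDeriv_add _ (mdifferentiableAt_fn hZ hX) (mdifferentiableAt_fn hZ hX'),
    dirDeriv_add _ (mdifferentiableAt_fn hX hY) (mdifferentiableAt_fn hX' hY),
    mlieBracket_add_left hX hX', mlieBracket_add_right hX hX', Pi.add_apply, map_add,
    add_apply]
  ring

lemma koszul_add_right (hX : DiffAt X x) (hY : DiffAt Y x) (hZ : DiffAt Z x) (hZ' : DiffAt Z' x) :
    g.koszul X Y (Z + Z') x = g.koszul X Y Z x + g.koszul X Y Z' x := by
  have : CompleteSpace E := FiniteDimensional.complete ℝ E
  simp only [koszul, fn_add_left, fn_add_right, dirDeriv_add_left,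
    dirDeriv_add _ (mdifferentiableAt_fn hY hZ) (mdifferentiableAt_fn hY hZ'),
    dirDeriv_add _ (mdifferentiableAt_fn hZ hX) (mdifferentiableAt_fn hZ' hX),
    mlieBracket_add_left hZ hZ', mlieBracket_add_right hZ hZ', Pi.add_apply, map_add,
    add_apply]
  ring

lemma koszul_add_mid (hX : DiffAt X x) (hY : DiffAt Y x) (hY' : DiffAt Y' x) (hZ : DiffAt Z x) :
    g.koszul X (Y + Y') Z x = g.koszul X Y Z x + g.koszul X Y' Z x := by
  have : CompleteSpace E := FiniteDimensional.complete ℝ E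
  simp only [koszul, fn_add_left, fn_add_right, dirDeriv_add_left,
    dirDeriv_add _ (mdifferentiableAt_fn hY hZ) (mdifferentiableAt_fn hY' hZ),
    dirDeriv_add _ (mdifferentiableAt_fn hX hY) (mdifferentiableAt_fn hX hY'),
    mlieBracket_add_left hY hY', mlieBracket_add_right hY hY', Pi.add_apply, map_add,
    add_apply]
  ring

variable {a : M → ℝ}

lemma koszul_smul_left (ha : MDifferentiableAt 𝓘(ℝ, E) 𝓘(ℝ, ℝ) a x)
    (hX : DiffAt X x) (hY : DiffAt Y x) (hZ : DiffAt Z x) :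
    g.koszul (a • X) Y Z x = a x * g.koszul X Y Z x := by
  have : CompleteSpace E := FiniteDimensional.complete ℝ E
  simp only [koszul, fn_smul_left, fn_smul_right, dirDeriv_smul_left,
    dirDeriv_mul _ ha (mdifferentiableAt_fn hZ hX),
    dirDeriv_mul _ ha (mdifferentiableAt_fn hX hY),
    mlieBracket_smul_left ha hX, mlieBracket_smul_right ha hX, Pi.smul_apply', map_add, map_smul,
    add_apply, smul_apply, smul_eq_mul]
  rw [g.symm x (X x) (Z x)]
  simp only [dirDeriv, fn, g.symm x (Z x)]
  ring

lemma koszul_smul_right (ha : MDifferentiableAt 𝓘(ℝ, E) 𝓘(ℝ, ℝ) a x)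
    (hX : DiffAt X x) (hY : DiffAt Y x) (hZ : DiffAt Z x) :
    g.koszul X Y (a • Z) x = a x * g.koszul X Y Z x := by
  have : CompleteSpace E := FiniteDimensional.complete ℝ E
  simp only [koszul, fn_smul_left, fn_smul_right, dirDeriv_smul_left,
    dirDeriv_mul _ ha (mdifferentiableAt_fn hY hZ),
    dirDeriv_mul _ ha (mdifferentiableAt_fn hZ hX),
    mlieBracket_smul_left ha hZ, mlieBracket_smul_right ha hZ, Pi.smul_apply', map_add, map_smul,
    add_apply, smul_apply, smul_eq_mul]
  simp only [dirDeriv, fn, g.symm x (Z x)]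
  ring

lemma koszul_smul_mid (ha : MDifferentiableAt 𝓘(ℝ, E) 𝓘(ℝ, ℝ) a x)
    (hX : DiffAt X x) (hY : DiffAt Y x) (hZ : DiffAt Z x) :
    g.koszul X (a • Y) Z x = a x * g.koszul X Y Z x + dirDeriv X a x * g.inner x (Y x) (Z x) := by
  have : CompleteSpace E := FiniteDimensional.complete ℝ E
  simp only [koszul, fn_smul_left, fn_smul_right, dirDeriv_smul_left,
    dirDeriv_mul _ ha (mdifferentiableAt_fn hY hZ),
    dirDeriv_mul _ ha (mdifferentiableAt_fn hX hY),
    mlieBracket_smul_left ha hY, mlieBracket_smul_right ha hY, Pi.smul_apply', map_add, map_smul,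
    add_apply, smul_apply, smul_eq_mul]
  simp only [dirDeriv, fn, g.symm x (Y x)]
  ring

variable (g)

/-- The isomorphism `v ↦ g(v, ·)` between the tangent space and its dual. -/
def flat (x : M) : TangentSpace 𝓘(ℝ, E) x ≃ₗ[ℝ] Module.Dual ℝ (TangentSpace 𝓘(ℝ, E) x) :=
  LinearEquiv.ofInjectiveOfFinrankEq
    ((ContinuousLinearMap.coeLM ℝ).comp (g.inner x).toLinearMap)
    (by
      rw [← LinearMap.ker_eq_bot, LinearMap.ker_eq_bot']
      intro v hv
      exact g.nondegenerate x v fun w ↦ LinearMap.congr_fun hv w)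
    Subspace.dual_finrank_eq.symm

@[simp] lemma flat_apply (x : M) (v w : TangentSpace 𝓘(ℝ, E) x) :
    g.flat x v w = g.inner x v w := rfl

lemma inner_flat_symm (x : M) (L : Module.Dual ℝ (TangentSpace 𝓘(ℝ, E) x))
    (w : TangentSpace 𝓘(ℝ, E) x) : g.inner x ((g.flat x).symm L) w = L w := by
  rw [← flat_apply, LinearEquiv.apply_symm_apply]

/-- For a field `Y` differentiable at `x`, the bilinear form `(X_x, Z_x) ↦ g(∇_X Y, Z)(x)`. -/
def koszulForm (Y : ∀ x : M, TangentSpace 𝓘(ℝ, E) x) (x : M) (hY : DiffAt Y x) :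
    TangentSpace 𝓘(ℝ, E) x →L[ℝ] TangentSpace 𝓘(ℝ, E) x →L[ℝ] ℝ :=
  TensorialAt.mkHom₂ (I := 𝓘(ℝ, E)) (F := E) (F' := E) (fun X Z ↦ g.koszul X Y Z x) x
    (fun _ hZ ↦ ⟨fun ha hX ↦ koszul_smul_left ha hX hY hZ,
      fun hX hX' ↦ koszul_add_left hX hX' hY hZ⟩)
    (fun _ hX ↦ ⟨fun ha hZ ↦ koszul_smul_right ha hX hY hZ,
      fun hZ hZ' ↦ koszul_add_right hX hY hZ hZ'⟩)

lemma koszulForm_apply (hX : DiffAt X x) (hY : DiffAt Y x) (hZ : DiffAt Z x) :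
    g.koszulForm Y x hY (X x) (Z x) = g.koszul X Y Z x :=
  TensorialAt.mkHom₂_apply (I := 𝓘(ℝ, E)) (F := E) (F' := E) _ _ hX hZ

open Classical in
/-- The map `v ↦ ∇_v Y`, defined by Koszul's formula (and by `0` where `Y` is not
differentiable). -/
def nabla (Y : ∀ x : M, TangentSpace 𝓘(ℝ, E) x) (x : M) :
    TangentSpace 𝓘(ℝ, E) x →L[ℝ] TangentSpace 𝓘(ℝ, E) x :=
  if hY : DiffAt Y x then
    LinearMap.toContinuousLinearMap ((g.flat x).symm.toLinearMap ∘ₗ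
      (ContinuousLinearMap.coeLM ℝ) ∘ₗ (g.koszulForm Y x hY).toLinearMap)
  else 0

lemma inner_nabla (hX : DiffAt X x) (hY : DiffAt Y x) (hZ : DiffAt Z x) :
    g.inner x (g.nabla Y x (X x)) (Z x) = g.koszul X Y Z x := by
  rw [← g.koszulForm_apply hX hY hZ, nabla, dif_pos hY]
  exact g.inner_flat_symm x _ _

lemma nabla_ext {T : TangentSpace 𝓘(ℝ, E) x →L[ℝ] TangentSpace 𝓘(ℝ, E) x} (hY : DiffAt Y x)
    (h : ∀ X Z : ∀ x : M, TangentSpace 𝓘(ℝ, E) x, DiffAt X x → DiffAt Z x →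
      g.koszul X Y Z x = g.inner x (T (X x)) (Z x)) : g.nabla Y x = T := by
  ext v
  refine g.eq_of_inner_eq fun w ↦ ?_
  have hv : DiffAt (FiberBundle.extend E v) x := FiberBundle.mdifferentiableAt_extend ..
  have hw : DiffAt (FiberBundle.extend E w) x := FiberBundle.mdifferentiableAt_extend ..
  have := g.inner_nabla hv hY hw
  rw [h _ _ hv hw] at this
  simpa using this

/-- The Levi-Civita connection of `g`; `g.leviCivita Y x v` is `∇_v Y`. -/
def leviCivita : CovariantDerivative 𝓘(ℝ, E) E (TangentSpace 𝓘(ℝ, E) : M → Type _) where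
  toFun := g.nabla
  isCovariantDerivativeOnUniv :=
    { add := fun {Y Y' x} hY hY' _ ↦ by
        refine g.nabla_ext (mdifferentiableAt_add_section hY hY') fun X Z hX hZ ↦ ?_
        rw [koszul_add_mid hX hY hY' hZ, ← g.inner_nabla hX hY hZ, ← g.inner_nabla hX hY' hZ]
        simp
      leibniz := fun {Y a x} hY ha _ ↦ by
        refine g.nabla_ext (ha.smul_section hY) fun X Z hX hZ ↦ ?_
        rw [koszul_smul_mid ha hX hY hZ, ← g.inner_nabla hX hY hZ]
        simp [dirDeriv] }

/-- The Levi-Civita connection is torsion-free. -/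
lemma leviCivita_torsion (hX : DiffAt X x) (hY : DiffAt Y x) :
    g.leviCivita Y x (X x) - g.leviCivita X x (Y x) = mlieBracket 𝓘(ℝ, E) X Y x := by
  refine g.eq_of_inner_eq fun w ↦ ?_
  have hw : DiffAt (FiberBundle.extend E w) x := FiberBundle.mdifferentiableAt_extend ..
  have h1 := g.inner_nabla hX hY hw
  have h2 := g.inner_nabla hY hX hw
  rw [FiberBundle.extend_apply_self] at h1 h2
  change g.inner x (g.nabla Y x (X x) - g.nabla X x (Y x)) w = _
  have c : ∀ U V : ∀ x : M, TangentSpace 𝓘(ℝ, E) x, g.fn U V = g.fn V U :=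
    fun U V ↦ funext fun y ↦ g.symm y _ _
  rw [map_sub, sub_apply, h1, h2, koszul, koszul,
    FiberBundle.extend_apply_self, c Y X, c (FiberBundle.extend E w) X,
    c Y (FiberBundle.extend E w),
    mlieBracket_swap_apply (V := Y) (W := X),
    mlieBracket_swap_apply (V := X) (W := FiberBundle.extend E w),
    mlieBracket_swap_apply (V := Y) (W := FiberBundle.extend E w)]
  simp only [map_neg, neg_apply]
  ring

/-- The Levi-Civita connection is compatible with the metric. -/
lemma leviCivita_metric (hX : DiffAt X x) (hY : DiffAt Y x) (hZ : DiffAt Z x) :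
    dirDeriv X (g.fn Y Z) x
      = g.inner x (g.leviCivita Y x (X x)) (Z x) + g.inner x (Y x) (g.leviCivita Z x (X x)) := by
  change _ = g.inner x (g.nabla Y x (X x)) (Z x) + g.inner x (Y x) (g.nabla Z x (X x))
  have c : ∀ U V : ∀ x : M, TangentSpace 𝓘(ℝ, E) x, g.fn U V = g.fn V U :=
    fun U V ↦ funext fun y ↦ g.symm y _ _
  rw [g.symm x (Y x), g.inner_nabla hX hY hZ, g.inner_nabla hX hZ hY, koszul, koszul,
    c Y X, c Z X, c Z Y, mlieBracket_swap_apply (V := Z) (W := X),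
    mlieBracket_swap_apply (V := Y) (W := X), mlieBracket_swap_apply (V := Z) (W := Y)]
  simp only [map_neg, neg_apply]
  ring

/-- The curvature operator on vector fields,
`R(X, Y)Z = ∇_X ∇_Y Z - ∇_Y ∇_X Z - ∇_{[X, Y]} Z`, at the point `x`. -/
def curvatureField (X Y Z : ∀ x : M, TangentSpace 𝓘(ℝ, E) x) (x : M) : TangentSpace 𝓘(ℝ, E) x :=
  g.leviCivita (fun y ↦ g.leviCivita Z y (Y y)) x (X x)
    - g.leviCivita (fun y ↦ g.leviCivita Z y (X y)) x (Y x)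
    - g.leviCivita Z x (mlieBracket 𝓘(ℝ, E) X Y x)

/-- The curvature tensor at `x`, `g.curvature x u v w = R(u, v)w`: the trilinear map whose values
on a basis of the tangent space are given by the curvature operator applied to local smooth
vector fields that extend the basis vectors. -/
def curvature (x : M) :
    TangentSpace 𝓘(ℝ, E) x →ₗ[ℝ] TangentSpace 𝓘(ℝ, E) x →ₗ[ℝ] TangentSpace 𝓘(ℝ, E) x →ₗ[ℝ]
      TangentSpace 𝓘(ℝ, E) x :=
  let b := Module.finBasis ℝ (TangentSpace 𝓘(ℝ, E) x)
  b.constr ℝ fun i ↦ b.constr ℝ fun j ↦ b.constr ℝ fun k ↦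
    g.curvatureField (FiberBundle.extend E (b i)) (FiberBundle.extend E (b j))
      (FiberBundle.extend E (b k)) x

/-- The metric is flat: its curvature tensor vanishes identically. -/
def IsFlat : Prop := ∀ (x : M) (u v w : TangentSpace 𝓘(ℝ, E) x), g.curvature x u v w = 0

/-- The Ricci tensor, `Ric(v, w) = tr (u ↦ R(u, v)w)`. -/
def ricci (x : M) : TangentSpace 𝓘(ℝ, E) x →ₗ[ℝ] TangentSpace 𝓘(ℝ, E) x →ₗ[ℝ] ℝ :=
  LinearMap.mk₂ ℝ
    (fun v w ↦ LinearMap.trace ℝ (TangentSpace 𝓘(ℝ, E) x) (((g.curvature x).flip v).flip w))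
    (fun _ _ _ ↦ by rw [← map_add]; congr 1; ext; simp)
    (fun _ _ _ ↦ by rw [← map_smul]; congr 1; ext; simp)
    (fun _ _ _ ↦ by rw [← map_add]; congr 1; ext; simp)
    (fun _ _ _ ↦ by rw [← map_smul]; congr 1; ext; simp)

/-- The Ricci operator `Q`, determined by `g(Qv, w) = Ric(v, w)`. -/
def ricciOperator (x : M) : TangentSpace 𝓘(ℝ, E) x →ₗ[ℝ] TangentSpace 𝓘(ℝ, E) x :=
  (g.flat x).symm.toLinearMap ∘ₗ g.ricci x

/-- The scalar curvature. -/
def scal (x : M) : ℝ := LinearMap.trace ℝ (TangentSpace 𝓘(ℝ, E) x) (g.ricciOperator x)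

/-- The sectional curvature of the nondegenerate plane spanned by `v` and `w`. -/
def sectionalCurvature (x : M) (v w : TangentSpace 𝓘(ℝ, E) x) : ℝ :=
  g.inner x (g.curvature x v w w) v /
    (g.inner x v v * g.inner x w w - g.inner x v w ^ 2)

end PseudoRiemannianMetric

end Metric

section Structure

variable (E : Type*) [NormedAddCommGroup E] [NormedSpace ℝ E]
  (M : Type*) [TopologicalSpace M] [ChartedSpace E M] [IsManifold 𝓘(ℝ, E) ∞ M]

/-- A paracontact metric structure `(φ, ξ, η, g)` on a manifold `M` of dimension 3. -/
structure ParacontactMetricStructure where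
  /-- The associated metric. -/
  g : PseudoRiemannianMetric E M
  φ (x : M) : TangentSpace 𝓘(ℝ, E) x →L[ℝ] TangentSpace 𝓘(ℝ, E) x
  /-- The characteristic vector field. -/
  ξ (x : M) : TangentSpace 𝓘(ℝ, E) x
  /-- The paracontact form. -/
  η (x : M) : TangentSpace 𝓘(ℝ, E) x →L[ℝ] ℝ
  contMDiff_φ : ContMDiff 𝓘(ℝ, E) (𝓘(ℝ, E).prod 𝓘(ℝ, E →L[ℝ] E)) ∞
    (fun x ↦ TotalSpace.mk' (E →L[ℝ] E)
      (E := fun x : M ↦ TangentSpace 𝓘(ℝ, E) x →L[ℝ] TangentSpace 𝓘(ℝ, E) x) x (φ x))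
  contMDiff_ξ : ContMDiff 𝓘(ℝ, E) 𝓘(ℝ, E).tangent ∞
    (fun x ↦ (TotalSpace.mk' E x (ξ x) : TangentBundle 𝓘(ℝ, E) M))
  contMDiff_η : ContMDiff 𝓘(ℝ, E) (𝓘(ℝ, E).prod 𝓘(ℝ, E →L[ℝ] ℝ)) ∞
    (fun x ↦ TotalSpace.mk' (E →L[ℝ] ℝ) (E := fun x : M ↦ TangentSpace 𝓘(ℝ, E) x →L[ℝ] ℝ) x (η x))
  /-- The three-form `η ∧ dη` vanishes at no point. -/
  contact (x : M) : ∃ X Y Z : ∀ x : M, TangentSpace 𝓘(ℝ, E) x,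
    DiffAt X x ∧ DiffAt Y x ∧ DiffAt Z x ∧
    η x (X x) * extDeriv η Y Z x + η x (Y x) * extDeriv η Z X x
      + η x (Z x) * extDeriv η X Y x ≠ 0
  η_ξ (x : M) : η x (ξ x) = 1
  extDeriv_ξ (x : M) (X : ∀ x : M, TangentSpace 𝓘(ℝ, E) x) (hX : DiffAt X x) :
    extDeriv η ξ X x = 0
  extDeriv_eq (x : M) (X Y : ∀ x : M, TangentSpace 𝓘(ℝ, E) x) (hX : DiffAt X x) (hY : DiffAt Y x) :
    extDeriv η X Y x = g.inner x (X x) (φ x (Y x))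
  η_eq (x : M) (v : TangentSpace 𝓘(ℝ, E) x) : η x v = g.inner x v (ξ x)
  φ_sq (x : M) (v : TangentSpace 𝓘(ℝ, E) x) : φ x (φ x v) = v - η x v • ξ x

namespace ParacontactMetricStructure

variable {E M} (S : ParacontactMetricStructure E M)

/-- The vector field `φX`. -/
def φField (X : ∀ x : M, TangentSpace 𝓘(ℝ, E) x) (x : M) : TangentSpace 𝓘(ℝ, E) x := S.φ x (X x)

variable {S} in
lemma diffAt_φField {X : ∀ x : M, TangentSpace 𝓘(ℝ, E) x} {x : M} (hX : DiffAt X x) :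
    DiffAt (S.φField X) x :=
  MDifferentiableAt.clm_bundle_apply (F₁ := E) (F₂ := E)
    ((S.contMDiff_φ x).mdifferentiableAt (by simp)) hX

/-- The value at `x` of the vector field `(1/2) (£_ξ φ)X = (1/2) ([ξ, φX] - φ[ξ, X])`. -/
def hField (X : ∀ x : M, TangentSpace 𝓘(ℝ, E) x) (x : M) : TangentSpace 𝓘(ℝ, E) x :=
  (1 / 2 : ℝ) • (mlieBracket 𝓘(ℝ, E) S.ξ (S.φField X) x - S.φ x (mlieBracket 𝓘(ℝ, E) S.ξ X x))

variable [FiniteDimensional ℝ E]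

lemma tensorialAt_hField (x : M) : TensorialAt 𝓘(ℝ, E) E (fun X ↦ S.hField X x) x where
  smul {a X} ha hX := by
    have : CompleteSpace E := FiniteDimensional.complete ℝ E
    have e : S.φField (a • X) = a • S.φField X := by ext y; simp [φField]
    simp only [hField, e, mlieBracket_smul_right ha hX,
      mlieBracket_smul_right ha (diffAt_φField hX), map_add, map_smul]
    simp only [φField]
    module
  add {X X'} hX hX' := by
    have : CompleteSpace E := FiniteDimensional.complete ℝ E
    have e : S.φField (X + X') = S.φField X + S.φField X' := by ext y; simp [φField]
    simp only [hField, e, mlieBracket_add_right hX hX',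
      mlieBracket_add_right (diffAt_φField hX) (diffAt_φField hX'), map_add]
    module

/-- The tensor field `h = (1/2) £_ξ φ`. -/
def h (x : M) : TangentSpace 𝓘(ℝ, E) x →ₗ[ℝ] TangentSpace 𝓘(ℝ, E) x :=
  (TensorialAt.mkHom (I := 𝓘(ℝ, E)) (F := E) (fun X ↦ S.hField X x) x
    (S.tensorialAt_hField x)).toLinearMap

/-- The tensor field `l`, `l v = R(v, ξ)ξ`. -/
def l (x : M) : TangentSpace 𝓘(ℝ, E) x →ₗ[ℝ] TangentSpace 𝓘(ℝ, E) x :=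
  ((S.g.curvature x).flip (S.ξ x)).flip (S.ξ x)

/-- All `ξ`-sectional curvatures (of nondegenerate planes spanned by `ξ` and a vector orthogonal
to `ξ`) are equal to `k`. -/
def HasConstXiSectionalCurvature (k : ℝ) : Prop :=
  ∀ (x : M) (v : TangentSpace 𝓘(ℝ, E) x), S.g.inner x v (S.ξ x) = 0 → S.g.inner x v v ≠ 0 →
    S.g.sectionalCurvature x (S.ξ x) v = k

/-- All `φ`-sectional curvatures (of nondegenerate planes spanned by `v` and `φ v`, with `v`
orthogonal to `ξ`) are equal to `c`. -/
def HasConstPhiSectionalCurvature (c : ℝ) : Prop :=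
  ∀ (x : M) (v : TangentSpace 𝓘(ℝ, E) x), S.g.inner x v (S.ξ x) = 0 → S.g.inner x v v ≠ 0 →
    S.g.sectionalCurvature x v (S.φ x v) = c

end ParacontactMetricStructure

end Structure

end Paracontact

end

noncomputable section

namespace Paracontact

open Filter Topology PseudoRiemannianMetric

set_option linter.unusedSectionVars false

/-! Near any point choose a unit spacelike field e orthogonal to ξ; then (ξ, e, φe) is a
pseudo-orthonormal frame with signs (1, 1, -1). The paracontact conditions and one component of the
Jacobi identity bring its brackets to the form [ξ, e] = p e + (τ - μ) φe, [ξ, φe] = (τ + μ) e - p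
φe, [e, φe] = -2ξ + α e + β φe (`isAdapted`). In this frame h e = μ e - p φe and h φe = p e - μ φe,
hence tr h² = 2(μ² - p²), while tr l = 2(μ² - p² - 1).

Let ∇' be the connection that ∇ induces on ker η, with connection form θ(X) = g(∇_X e, φe). The
condition Qφ = φQ yields ∇'_ξ h = 0 and a Codazzi equation for h (`structure_equations`), so that
∇'h depends on only two functions, a = e(μ) - 2αp and b = e(p) - 2αμ. Commuting ξ with e and φe on μ
and p, and eliminating with the Jacobi identity, gives p a = μ b and μ a = p b (`codazzi_system`).
These two equations say that μ² - p² has zero derivative along φe and e; along ξ this follows from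
∇'_ξ h = 0. So tr l is locally constant, hence equal to a constant 2k.

If k = -1, then tr h² = 2(k + 1) = 0. Otherwise the determinant μ² - p² = k + 1 of the linear system
is invertible, so a = b = 0 and h is ∇'-parallel. Being parallel and invertible on ker η, h forces
dθ(e, φe) = 0 (`curvature_form_eq_zero`). Every frame component of R is then 0 or ±k (`hasConstR`),
and flatness for k = 0, or the sectional and scalar curvatures, are read off.

The structure equations live in the algebra of smooth functions on the domain of the frame, with the
three frame derivations; the lemmas above become commutative algebra there. -/

section

/-! ### Calculus of functions and vector fields that are smooth near a point -/

section Smooth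

variable {E : Type*} [NormedAddCommGroup E] [NormedSpace ℝ E]
  {M : Type*} [TopologicalSpace M] [ChartedSpace E M]

/-- The function `f` is smooth at every point of a neighbourhood of `x`. -/
def SmoothFn (f : M → ℝ) (x : M) : Prop := ∀ᶠ y in 𝓝 x, ContMDiffAt 𝓘(ℝ, E) 𝓘(ℝ, ℝ) ∞ f y

variable {f f' : M → ℝ} {x : M}

lemma SmoothFn.mdifferentiableAt (h : SmoothFn (E := E) f x) :
    MDifferentiableAt 𝓘(ℝ, E) 𝓘(ℝ, ℝ) f x :=
  h.self_of_nhds.mdifferentiableAt (by simp)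

lemma SmoothFn.of_eventuallyEq (h : SmoothFn (E := E) f x) (e : f' =ᶠ[𝓝 x] f) :
    SmoothFn (E := E) f' x := by
  filter_upwards [h, e.eventuallyEq_nhds] with y hy ey using hy.congr_of_eventuallyEq ey

lemma SmoothFn.add (h : SmoothFn (E := E) f x) (h' : SmoothFn (E := E) f' x) :
    SmoothFn (E := E) (f + f') x := by
  filter_upwards [h, h'] with y hy hy' using hy.add hy'

lemma SmoothFn.mul (h : SmoothFn (E := E) f x) (h' : SmoothFn (E := E) f' x) :
    SmoothFn (E := E) (f * f') x := by
  filter_upwards [h, h'] with y hy hy' using hy.mul hy'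

lemma smoothFn_const (c : ℝ) : SmoothFn (E := E) (fun _ : M ↦ c) x :=
  Eventually.of_forall fun _ ↦ contMDiffAt_const

lemma dirDeriv_congr {X : ∀ x : M, TangentSpace 𝓘(ℝ, E) x} (e : f =ᶠ[𝓝 x] f') :
    dirDeriv X f x = dirDeriv X f' x := by
  simp only [dirDeriv, mvfderiv, e.mfderiv_eq]
  rfl

lemma dirDeriv_const (X : ∀ x : M, TangentSpace 𝓘(ℝ, E) x) (c : ℝ) :
    dirDeriv X (fun _ ↦ c) x = 0 := by
  rw [dirDeriv, mvfderiv_const]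
  simp

variable [IsManifold 𝓘(ℝ, E) ∞ M]

/-- The vector field `X` is smooth at every point of a neighbourhood of `x`. -/
def SmoothField (X : ∀ x : M, TangentSpace 𝓘(ℝ, E) x) (x : M) : Prop :=
  ∀ᶠ y in 𝓝 x, ContMDiffAt 𝓘(ℝ, E) 𝓘(ℝ, E).tangent ∞ (T% X) y

variable {X X' Y Y' Z Z' : ∀ x : M, TangentSpace 𝓘(ℝ, E) x} 

lemma SmoothField.diffAt (h : SmoothField X x) : DiffAt X x :=
  h.self_of_nhds.mdifferentiableAt (by simp)

/-- The differential of f is a smooth section of the cotangent bundle, and the derivative is its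
pairing with X. -/
lemma contMDiffAt_dirDeriv {x : M} (hX : ContMDiffAt 𝓘(ℝ, E) 𝓘(ℝ, E).tangent ∞ (T% X) x)
    (hf : ContMDiffAt 𝓘(ℝ, E) 𝓘(ℝ, ℝ) ∞ f x) :
    ContMDiffAt 𝓘(ℝ, E) 𝓘(ℝ, ℝ) ∞ (dirDeriv X f) x := by
  have h1 := ContMDiffAt.mfderiv_const (m := ∞) hf (by simp)
  have h2 : ContMDiffAt 𝓘(ℝ, E) (𝓘(ℝ, E).prod 𝓘(ℝ, E →L[ℝ] ℝ)) ∞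
      (fun y ↦ TotalSpace.mk' (E →L[ℝ] ℝ)
        (E := fun y : M ↦ TangentSpace 𝓘(ℝ, E) y →L[ℝ] Bundle.Trivial M ℝ y) y
        (mvfderiv 𝓘(ℝ, E) f y)) x := by
    rw [contMDiffAt_hom_bundle]
    refine ⟨contMDiffAt_id, ?_⟩
    refine h1.congr_of_eventuallyEq (Eventually.of_forall fun y ↦ ?_)
    ext v
    simp [inTangentCoordinates, ContinuousLinearMap.inCoordinates, mvfderiv]
    rfl
  have h := ContMDiffAt.clm_bundle_apply (F₁ := E) (F₂ := ℝ) (E₂ := Bundle.Trivial M ℝ) h2 hX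
  rw [contMDiffAt_section] at h
  exact h

lemma contMDiffAt_mlieBracket [CompleteSpace E] {x : M}
    (hX : ContMDiffAt 𝓘(ℝ, E) 𝓘(ℝ, E).tangent ∞ (T% X) x)
    (hY : ContMDiffAt 𝓘(ℝ, E) 𝓘(ℝ, E).tangent ∞ (T% Y) x) :
    ContMDiffAt 𝓘(ℝ, E) 𝓘(ℝ, E).tangent ∞ (T% (mlieBracket 𝓘(ℝ, E) X Y)) x := by
  have : IsManifold 𝓘(ℝ, E) (((⊤ : ℕ∞) : WithTop ℕ∞) + 1) M := by simpa
  have : IsManifold 𝓘(ℝ, E) (minSmoothness ℝ 2) M := by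
    rw [minSmoothness_of_isRCLikeNormedField]; infer_instance
  exact ContMDiffAt.mlieBracket_vectorField (m := ⊤) (n := ⊤) hX hY (by simp)

lemma SmoothField.of_eventuallyEq (h : SmoothField X x) (e : X' =ᶠ[𝓝 x] X) : SmoothField X' x := by
  filter_upwards [h, e.eventuallyEq_nhds] with y hy ey
  refine hy.congr_of_eventuallyEq ?_
  filter_upwards [ey] with z hz
  simp [hz]

lemma SmoothField.eventually (h : SmoothField X x) : ∀ᶠ y in 𝓝 x, SmoothField X y :=
  eventually_eventually_nhds.2 h

lemma SmoothField.add (h : SmoothField X x) (h' : SmoothField X' x) : SmoothField (X + X') x := by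
  filter_upwards [h, h'] with y hy hy' using hy.add_section hy'

lemma SmoothField.smul (h : SmoothFn (E := E) f x) (h' : SmoothField X x) :
    SmoothField (f • X) x := by
  filter_upwards [h, h'] with y hy hy' using hy.smul_section hy'

lemma smoothField_zero : SmoothField (0 : ∀ x : M, TangentSpace 𝓘(ℝ, E) x) x :=
  Eventually.of_forall fun y ↦ (contMDiff_zeroSection ℝ (TangentSpace 𝓘(ℝ, E) : M → Type _)) y

lemma SmoothField.sum {ι : Type*} {s : Finset ι} {X : ι → ∀ x : M, TangentSpace 𝓘(ℝ, E) x}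
    (h : ∀ i ∈ s, SmoothField (X i) x) : SmoothField (∑ i ∈ s, X i) x := by
  classical
  induction s using Finset.induction_on with
  | empty => simpa using smoothField_zero
  | insert i s hi ih =>
    rw [Finset.sum_insert hi]
    exact (h i (by simp)).add (ih fun j hj ↦ h j (by simp [hj]))

lemma SmoothField.dirDeriv (hX : SmoothField X x) (hf : SmoothFn (E := E) f x) :
    SmoothFn (E := E) (dirDeriv X f) x := by
  filter_upwards [hX, hf] with y hy hy' using contMDiffAt_dirDeriv hy hy'

lemma SmoothField.mlieBracket [CompleteSpace E] (hX : SmoothField X x) (hY : SmoothField Y x) :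
    SmoothField (mlieBracket 𝓘(ℝ, E) X Y) x := by
  filter_upwards [hX, hY] with y hy hy' using contMDiffAt_mlieBracket hy hy'

lemma smoothField_extend (v : TangentSpace 𝓘(ℝ, E) x) :
    SmoothField (FiberBundle.extend E v) x := by
  obtain ⟨s, hs, h⟩ := FiberBundle.exists_contMDiffOn_extend (k := ∞) 𝓘(ℝ, E) E v
  filter_upwards [eventually_mem_nhds_iff.2 hs] with y hy using h.contMDiffAt hy

lemma smoothFn_fn {g : PseudoRiemannianMetric E M} (hX : SmoothField X x) (hY : SmoothField Y x) :
    SmoothFn (E := E) (g.fn X Y) x := by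
  filter_upwards [hX, hY] with y hy hy'
  have h : ContMDiffAt 𝓘(ℝ, E) (𝓘(ℝ, E).prod 𝓘(ℝ, ℝ)) ∞
      (fun m ↦ TotalSpace.mk' ℝ (E := Bundle.Trivial M ℝ) m (g.inner m (X m) (Y m))) y :=
    ContMDiffAt.clm_bundle_apply₂ (F₁ := E) (F₂ := E) (g.contMDiff y) hy hy'
  rw [contMDiffAt_section] at h
  exact h

/-- The Jacobi identity for smooth vector fields. -/
lemma jacobi [CompleteSpace E] (hX : SmoothField X x) (hY : SmoothField Y x)
    (hZ : SmoothField Z x) :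
    mlieBracket 𝓘(ℝ, E) X (mlieBracket 𝓘(ℝ, E) Y Z) x =
      mlieBracket 𝓘(ℝ, E) (mlieBracket 𝓘(ℝ, E) X Y) Z x
        + mlieBracket 𝓘(ℝ, E) Y (mlieBracket 𝓘(ℝ, E) X Z) x := by
  have : IsManifold 𝓘(ℝ, E) (minSmoothness ℝ 3) M := by
    rw [minSmoothness_of_isRCLikeNormedField]; infer_instance
  have e : minSmoothness ℝ 2 ≤ ∞ := by
    rw [minSmoothness_of_isRCLikeNormedField]; exact WithTop.coe_le_coe.2 le_top
  exact leibniz_identity_mlieBracket_apply (hX.self_of_nhds.of_le e) (hY.self_of_nhds.of_le e)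
    (hZ.self_of_nhds.of_le e)

lemma mlieBracket_smul_right_dirDeriv [CompleteSpace E]
    (hf : SmoothFn (E := E) f x) (hY : SmoothField Y x) :
    mlieBracket 𝓘(ℝ, E) X (f • Y) x
      = dirDeriv X f x • Y x + f x • mlieBracket 𝓘(ℝ, E) X Y x :=
  mlieBracket_smul_right hf.mdifferentiableAt hY.diffAt

/-- The derivation attached to a Lie bracket is the commutator of the derivations. -/
lemma dirDeriv_mlieBracket [CompleteSpace E] [Nontrivial E] (hX : SmoothField X x)
    (hY : SmoothField Y x) (hf : SmoothFn (E := E) f x) :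
    dirDeriv (mlieBracket 𝓘(ℝ, E) X Y) f x
      = dirDeriv X (dirDeriv Y f) x - dirDeriv Y (dirDeriv X f) x := by
  have : Nontrivial (TangentSpace 𝓘(ℝ, E) x) := inferInstanceAs (Nontrivial E)
  obtain ⟨v, hv⟩ := exists_ne (0 : TangentSpace 𝓘(ℝ, E) x)
  have hZ := smoothField_extend v
  set Z := FiberBundle.extend E v
  -- Apply the Jacobi identity to X, Y and f • Z with Z x ≠ 0. After expansion, the terms that
  -- survive are multiples of Z x, and comparing their coefficients gives the claim.
  have key (W : ∀ x : M, TangentSpace 𝓘(ℝ, E) x) (V : ∀ x : M, TangentSpace 𝓘(ℝ, E) x)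
      (hW : SmoothField W x) (hV : SmoothField V x) :
      mlieBracket 𝓘(ℝ, E) W (mlieBracket 𝓘(ℝ, E) V (f • Z)) x
        = dirDeriv W (dirDeriv V f) x • Z x + dirDeriv V f x • mlieBracket 𝓘(ℝ, E) W Z x
          + (dirDeriv W f x • mlieBracket 𝓘(ℝ, E) V Z x
          + f x • mlieBracket 𝓘(ℝ, E) W (mlieBracket 𝓘(ℝ, E) V Z) x) := by
    have e : mlieBracket 𝓘(ℝ, E) V (f • Z)
        =ᶠ[𝓝 x] dirDeriv V f • Z + f • mlieBracket 𝓘(ℝ, E) V Z := by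
      filter_upwards [eventually_eventually_nhds.2 hf, hZ.eventually] with y hy hy'
      exact mlieBracket_smul_right_dirDeriv hy hy'
    rw [(EventuallyEq.refl _ W).mlieBracket_vectorField_eq e,
      mlieBracket_add_right (SmoothField.smul (hV.dirDeriv hf) hZ).diffAt
        (SmoothField.smul hf (hV.mlieBracket hZ)).diffAt,
      mlieBracket_smul_right_dirDeriv (hV.dirDeriv hf) hZ,
      mlieBracket_smul_right_dirDeriv hf (hV.mlieBracket hZ)]
  have h1 := jacobi hX hY (SmoothField.smul hf hZ)
  rw [key X Y hX hY, key Y X hY hX, mlieBracket_smul_right_dirDeriv hf hZ, jacobi hX hY hZ] at h1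
  have h2 : (dirDeriv (mlieBracket 𝓘(ℝ, E) X Y) f x
      - (dirDeriv X (dirDeriv Y f) x - dirDeriv Y (dirDeriv X f) x)) • Z x = 0 := by
    linear_combination (norm := module) (-1 : ℝ) • h1
  rw [smul_eq_zero, or_iff_left (by simpa [Z] using hv)] at h2
  linarith

end Smooth

end

section

/-! ### Pseudo-orthonormal frames and tensoriality of the curvature -/

section Frames

variable {E : Type*} [NormedAddCommGroup E] [NormedSpace ℝ E] [FiniteDimensional ℝ E]
  {M : Type*} [TopologicalSpace M] [ChartedSpace E M] [IsManifold 𝓘(ℝ, E) ∞ M]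
  {g : PseudoRiemannianMetric E M}
  {X X' Y Y' Z Z' : ∀ x : M, TangentSpace 𝓘(ℝ, E) x} {f f' : M → ℝ} {x : M}

lemma leviCivita_add (hY : DiffAt Y x) (hY' : DiffAt Y' x) (v : TangentSpace 𝓘(ℝ, E) x) :
    g.leviCivita (Y + Y') x v = g.leviCivita Y x v + g.leviCivita Y' x v := by
  rw [g.leviCivita.isCovariantDerivativeOnUniv.add hY hY']
  rfl

lemma leviCivita_smul (hf : SmoothFn (E := E) f x) (hY : DiffAt Y x) :
    g.leviCivita (f • Y) x (X x) = f x • g.leviCivita Y x (X x) + dirDeriv X f x • Y x := by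
  rw [g.leviCivita.isCovariantDerivativeOnUniv.leibniz hY hf.mdifferentiableAt]
  rfl

lemma leviCivita_congr (hY : DiffAt Y x) (hY' : DiffAt Y' x) (e : Y =ᶠ[𝓝 x] Y') :
    g.leviCivita Y x = g.leviCivita Y' x :=
  g.leviCivita.isCovariantDerivativeOnUniv.congr_of_eventuallyEq hY hY' univ_mem e

/-- A smooth pseudo-orthonormal frame on an open set. -/
structure IsOrthonormalFrame {ι : Type*} [Fintype ι] [DecidableEq ι]
    (g : PseudoRiemannianMetric E M) (U : Set M) (F : ι → ∀ x : M, TangentSpace 𝓘(ℝ, E) x)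
    (ε : ι → ℝ) : Prop where
  isOpen : IsOpen U
  card : Fintype.card ι = Module.finrank ℝ E
  smooth (i : ι) : ∀ y ∈ U, SmoothField (F i) y
  inner_eq (i j : ι) : ∀ y ∈ U, g.inner y (F i y) (F j y) = if i = j then ε i else 0
  sign_sq (i : ι) : ε i * ε i = 1

namespace IsOrthonormalFrame

variable {ι : Type*} [Fintype ι] [DecidableEq ι] {U : Set M}
  {F : ι → ∀ x : M, TangentSpace 𝓘(ℝ, E) x} {ε : ι → ℝ}

lemma linearIndependent (h : IsOrthonormalFrame g U F ε) (hx : x ∈ U) :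
    LinearIndependent ℝ fun i ↦ F i x := by
  rw [Fintype.linearIndependent_iff]
  intro a ha i
  have := congrArg (g.inner x (F i x)) ha
  simp [h.inner_eq _ _ x hx] at this
  rcases this with h1 | h1
  · exact h1
  · have := h.sign_sq i
    simp [h1] at this

/-- The basis of the tangent space at a point given by a frame. -/
def basis (h : IsOrthonormalFrame g U F ε) (hx : x ∈ U) :
    Module.Basis ι ℝ (TangentSpace 𝓘(ℝ, E) x) :=
  basisOfLinearIndependentOfCardEqFinrank' (fun i ↦ F i x) (h.linearIndependent hx) h.card

@[simp] lemma basis_apply (h : IsOrthonormalFrame g U F ε) (hx : x ∈ U) (i : ι) :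
    h.basis hx i = F i x :=
  congrFun (coe_basisOfLinearIndependentOfCardEqFinrank' (fun i ↦ F i x) _ _) i

lemma basis_repr (h : IsOrthonormalFrame g U F ε) (hx : x ∈ U) (v : TangentSpace 𝓘(ℝ, E) x)
    (i : ι) : (h.basis hx).repr v i = ε i * g.inner x v (F i x) := by
  conv_rhs => rw [← (h.basis hx).sum_repr v]
  simp [h.inner_eq _ _ x hx]
  rw [mul_left_comm, h.sign_sq, mul_one]

lemma eq_sum (h : IsOrthonormalFrame g U F ε) (hx : x ∈ U) (v : TangentSpace 𝓘(ℝ, E) x) :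
    v = ∑ i, (ε i * g.inner x v (F i x)) • F i x := by
  conv_lhs => rw [← (h.basis hx).sum_repr v]
  simp [h.basis_repr]

lemma inner_eq_sum (h : IsOrthonormalFrame g U F ε) (hx : x ∈ U)
    (v w : TangentSpace 𝓘(ℝ, E) x) :
    g.inner x v w = ∑ i, ε i * (g.inner x v (F i x) * g.inner x w (F i x)) := by
  conv_lhs => rw [h.eq_sum hx w]
  simp only [map_sum, map_smul, smul_eq_mul]
  exact Finset.sum_congr rfl fun i _ ↦ by ring

lemma ext_inner (h : IsOrthonormalFrame g U F ε) (hx : x ∈ U) {v w : TangentSpace 𝓘(ℝ, E) x}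
    (e : ∀ i, g.inner x v (F i x) = g.inner x w (F i x)) : v = w := by
  rw [h.eq_sum hx v, h.eq_sum hx w]
  simp [e]

lemma trace_eq (h : IsOrthonormalFrame g U F ε) (hx : x ∈ U)
    (T : TangentSpace 𝓘(ℝ, E) x →ₗ[ℝ] TangentSpace 𝓘(ℝ, E) x) :
    LinearMap.trace ℝ _ T = ∑ i, ε i * g.inner x (T (F i x)) (F i x) := by
  rw [LinearMap.trace_eq_matrix_trace ℝ (h.basis hx), Matrix.trace]
  simp [LinearMap.toMatrix_apply, h.basis_repr]

lemma smoothField_of_inner (h : IsOrthonormalFrame g U F ε) (hx : x ∈ U)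
    (e : ∀ i, SmoothFn (E := E) (fun y ↦ g.inner y (X y) (F i y)) x) : SmoothField X x := by
  have : SmoothField (∑ i, (fun y ↦ ε i * g.inner y (X y) (F i y)) • F i) x :=
    SmoothField.sum fun i _ ↦ SmoothField.smul ((smoothFn_const (ε i)).mul (e i)) (h.smooth i x hx)
  refine this.of_eventuallyEq ?_
  filter_upwards [h.isOpen.mem_nhds hx] with y hy
  rw [Finset.sum_apply]
  exact h.eq_sum hy (X y)

lemma smoothFn_koszul (hX : SmoothField X x) (hY : SmoothField Y x) (hZ : SmoothField Z x) :
    SmoothFn (E := E) (g.koszul X Y Z) x := by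
  have : CompleteSpace E := FiniteDimensional.complete ℝ E
  have n {f : M → ℝ} (hf : SmoothFn (E := E) f x) : SmoothFn (E := E) ((fun _ ↦ -1) * f) x :=
    (smoothFn_const _).mul hf
  refine ((smoothFn_const (1 / 2)).mul ((((((hX.dirDeriv (smoothFn_fn (g := g) hY hZ)).add
    (hY.dirDeriv (smoothFn_fn (g := g) hZ hX))).add (n (hZ.dirDeriv (smoothFn_fn (g := g) hX hY)))).add
    (smoothFn_fn (g := g) (hX.mlieBracket hY) hZ)).add
    (n (smoothFn_fn (g := g) (hY.mlieBracket hZ) hX))).add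
    (smoothFn_fn (g := g) (hZ.mlieBracket hX) hY))).of_eventuallyEq (Eventually.of_forall fun y ↦ ?_)
  simp only [koszul, fn, Pi.mul_apply, Pi.add_apply]
  ring

/-- Koszul's formula makes every frame component of ∇_X Y smooth, and smooth components suffice. -/
lemma smoothField_leviCivita (h : IsOrthonormalFrame g U F ε) (hx : x ∈ U)
    (hX : SmoothField X x) (hY : SmoothField Y x) :
    SmoothField (fun y ↦ g.leviCivita Y y (X y)) x := by
  refine h.smoothField_of_inner hx fun i ↦
    (smoothFn_koszul (g := g) hX hY (h.smooth i x hx)).of_eventuallyEq ?_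
  filter_upwards [hX.eventually, hY.eventually, (h.smooth i x hx).eventually] with y h1 h2 h3
  exact g.inner_nabla h1.diffAt h2.diffAt h3.diffAt

lemma curvatureField_swap (X Y Z : ∀ x : M, TangentSpace 𝓘(ℝ, E) x) (x : M) :
    g.curvatureField X Y Z x = -g.curvatureField Y X Z x := by
  rw [curvatureField, curvatureField, mlieBracket_swap_apply, map_neg]
  abel

/-- The term (Yf) ∇_X Z arising from ∇_Y (f ∇_X Z) is cancelled by the term -(Yf) X of [fX, Y]. -/
lemma curvatureField_smul_left (h : IsOrthonormalFrame g U F ε) (hx : x ∈ U)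
    (hf : SmoothFn (E := E) f x) (hX : SmoothField X x) (hZ : SmoothField Z x) :
    g.curvatureField (f • X) Y Z x = f x • g.curvatureField X Y Z x := by
  have : CompleteSpace E := FiniteDimensional.complete ℝ E
  have e : (fun y ↦ g.leviCivita Z y ((f • X) y)) = f • fun y ↦ g.leviCivita Z y (X y) := by
    ext y; simp
  have e2 : mlieBracket 𝓘(ℝ, E) (f • X) Y x
      = -dirDeriv Y f x • X x + f x • mlieBracket 𝓘(ℝ, E) X Y x :=
    mlieBracket_smul_left hf.mdifferentiableAt hX.diffAt
  rw [curvatureField, e, leviCivita_smul hf (h.smoothField_leviCivita hx hX hZ).diffAt, e2,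
    curvatureField]
  simp only [Pi.smul_apply', map_smul, map_add]
  module

lemma curvatureField_add_left (h : IsOrthonormalFrame g U F ε) (hx : x ∈ U)
    (hX : SmoothField X x) (hX' : SmoothField X' x) (hZ : SmoothField Z x) :
    g.curvatureField (X + X') Y Z x = g.curvatureField X Y Z x + g.curvatureField X' Y Z x := by
  have : CompleteSpace E := FiniteDimensional.complete ℝ E
  have e : (fun y ↦ g.leviCivita Z y ((X + X') y))
      = (fun y ↦ g.leviCivita Z y (X y)) + fun y ↦ g.leviCivita Z y (X' y) := by
    ext y; simp
  rw [curvatureField, e, leviCivita_add (h.smoothField_leviCivita hx hX hZ).diffAt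
    (h.smoothField_leviCivita hx hX' hZ).diffAt, mlieBracket_add_left hX.diffAt hX'.diffAt,
    curvatureField, curvatureField]
  simp only [Pi.add_apply, map_add]
  abel

lemma curvatureField_congr_left (h : IsOrthonormalFrame g U F ε) (hx : x ∈ U)
    (hX : SmoothField X x) (hX' : SmoothField X' x) (hZ : SmoothField Z x) (e : X =ᶠ[𝓝 x] X') :
    g.curvatureField X Y Z x = g.curvatureField X' Y Z x := by
  rw [curvatureField, curvatureField, e.eq_of_nhds,
    e.mlieBracket_vectorField_eq (I := 𝓘(ℝ, E)) (.refl _ Y),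
    leviCivita_congr (h.smoothField_leviCivita hx hX hZ).diffAt
      (h.smoothField_leviCivita hx hX' hZ).diffAt]
  filter_upwards [e] with y hy
  rw [hy]

lemma curvatureField_congr_right (h : IsOrthonormalFrame g U F ε) (hx : x ∈ U)
    (hX : SmoothField X x) (hY : SmoothField Y x) (hZ : SmoothField Z x) (hZ' : SmoothField Z' x)
    (e : Z =ᶠ[𝓝 x] Z') :
    g.curvatureField X Y Z x = g.curvatureField X Y Z' x := by
  have key (W : ∀ x : M, TangentSpace 𝓘(ℝ, E) x) : (fun y ↦ g.leviCivita Z y (W y))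
      =ᶠ[𝓝 x] fun y ↦ g.leviCivita Z' y (W y) := by
    filter_upwards [e.eventuallyEq_nhds, hZ.eventually, hZ'.eventually] with y hy h1 h2
    rw [leviCivita_congr h1.diffAt h2.diffAt hy]
  rw [curvatureField, curvatureField, leviCivita_congr hZ.diffAt hZ'.diffAt e,
    leviCivita_congr (h.smoothField_leviCivita hx hY hZ).diffAt
      (h.smoothField_leviCivita hx hY hZ').diffAt (key Y),
    leviCivita_congr (h.smoothField_leviCivita hx hX hZ).diffAt
      (h.smoothField_leviCivita hx hX hZ').diffAt (key X)]

lemma curvatureField_add_right (h : IsOrthonormalFrame g U F ε) (hx : x ∈ U)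
    (hX : SmoothField X x) (hY : SmoothField Y x) (hZ : SmoothField Z x) (hZ' : SmoothField Z' x) :
    g.curvatureField X Y (Z + Z') x = g.curvatureField X Y Z x + g.curvatureField X Y Z' x := by
  have key (V W : ∀ x : M, TangentSpace 𝓘(ℝ, E) x) (hV : SmoothField V x) :
      g.leviCivita (fun y ↦ g.leviCivita (Z + Z') y (V y)) x (W x)
        = g.leviCivita (fun y ↦ g.leviCivita Z y (V y)) x (W x)
          + g.leviCivita (fun y ↦ g.leviCivita Z' y (V y)) x (W x) := by
    rw [← leviCivita_add (h.smoothField_leviCivita hx hV hZ).diffAt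
      (h.smoothField_leviCivita hx hV hZ').diffAt]
    rw [leviCivita_congr (h.smoothField_leviCivita hx hV (hZ.add hZ')).diffAt
      ((h.smoothField_leviCivita hx hV hZ).add (h.smoothField_leviCivita hx hV hZ')).diffAt]
    filter_upwards [hZ.eventually, hZ'.eventually] with y h1 h2
    rw [leviCivita_add h1.diffAt h2.diffAt]
    rfl
  rw [curvatureField, key Y X hY, key X Y hX, leviCivita_add hZ.diffAt hZ'.diffAt,
    curvatureField, curvatureField]
  abel

/-- The first-order terms in f cancel in pairs, and the second-order ones add up to X(Yf) - Y(Xf) -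
[X, Y]f = 0. -/
lemma curvatureField_smul_right [Nontrivial E] (h : IsOrthonormalFrame g U F ε) (hx : x ∈ U)
    (hf : SmoothFn (E := E) f x) (hX : SmoothField X x) (hY : SmoothField Y x)
    (hZ : SmoothField Z x) :
    g.curvatureField X Y (f • Z) x = f x • g.curvatureField X Y Z x := by
  have : CompleteSpace E := FiniteDimensional.complete ℝ E
  have key (V W : ∀ x : M, TangentSpace 𝓘(ℝ, E) x) (hV : SmoothField V x) :
      g.leviCivita (fun y ↦ g.leviCivita (f • Z) y (V y)) x (W x)
        = f x • g.leviCivita (fun y ↦ g.leviCivita Z y (V y)) x (W x)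
          + dirDeriv W f x • g.leviCivita Z x (V x)
          + (dirDeriv V f x • g.leviCivita Z x (W x) + dirDeriv W (dirDeriv V f) x • Z x) := by
    have h1 := h.smoothField_leviCivita hx hV hZ
    have h2 := hV.dirDeriv hf
    rw [← leviCivita_smul hf h1.diffAt, ← leviCivita_smul h2 hZ.diffAt,
      ← leviCivita_add (SmoothField.smul hf h1).diffAt (SmoothField.smul h2 hZ).diffAt]
    rw [leviCivita_congr (h.smoothField_leviCivita hx hV (SmoothField.smul hf hZ)).diffAt
      ((SmoothField.smul hf h1).add (SmoothField.smul h2 hZ)).diffAt]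
    filter_upwards [hZ.eventually, eventually_eventually_nhds.2 hf] with y h1 h2
    rw [leviCivita_smul h2 h1.diffAt]
    rfl
  rw [curvatureField, key Y X hY, key X Y hX, leviCivita_smul hf hZ.diffAt,
    dirDeriv_mlieBracket hX hY hf, curvatureField]
  module

/-- A `C^∞`-linear local operator on vector fields is determined by its values on a frame. -/
lemma expand (h : IsOrthonormalFrame g U F ε) (hx : x ∈ U) {V : Type*} [AddCommGroup V]
    [Module ℝ V] (T : (∀ x : M, TangentSpace 𝓘(ℝ, E) x) → V)
    (congr : ∀ X X', SmoothField X x → SmoothField X' x → X =ᶠ[𝓝 x] X' → T X = T X')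
    (add : ∀ X X', SmoothField X x → SmoothField X' x → T (X + X') = T X + T X')
    (smul : ∀ (f : M → ℝ) X, SmoothFn (E := E) f x → SmoothField X x → T (f • X) = f x • T X)
    (hX : SmoothField X x) :
    T X = ∑ i, (ε i * g.inner x (X x) (F i x)) • T (F i) := by
  have hsm (i : ι) : SmoothFn (E := E) (fun y ↦ ε i * g.inner y (X y) (F i y)) x :=
    (smoothFn_const (ε i)).mul (smoothFn_fn (g := g) hX (h.smooth i x hx))
  have hF (i : ι) := SmoothField.smul (hsm i) (h.smooth i x hx)
  have e : X =ᶠ[𝓝 x] ∑ i, (fun y ↦ ε i * g.inner y (X y) (F i y)) • F i := by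
    filter_upwards [h.isOpen.mem_nhds hx] with y hy
    have e' : (∑ i, (fun y ↦ ε i * g.inner y (X y) (F i y)) • F i) y
        = ∑ i, (ε i * g.inner y (X y) (F i y)) • F i y := by simp
    exact (h.eq_sum hy (X y)).trans e'.symm
  have hsum (s : Finset ι) : T (∑ i ∈ s, (fun y ↦ ε i * g.inner y (X y) (F i y)) • F i)
      = ∑ i ∈ s, (ε i * g.inner x (X x) (F i x)) • T (F i) := by
    induction s using Finset.induction_on with
    | empty =>
      have := smul (fun _ ↦ 0) 0 (smoothFn_const 0) smoothField_zero
      simpa using this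
    | insert i s hi ih =>
      rw [Finset.sum_insert hi, Finset.sum_insert hi,
        add _ _ (hF i) (SmoothField.sum fun j _ ↦ hF j), ih, smul _ _ (hsm i) (h.smooth i x hx)]
  rw [congr _ _ hX (SmoothField.sum fun i _ ↦ hF i) e, hsum]

/-- The trilinear map whose values on a frame are given by the curvature operator. -/
def curvatureMap (h : IsOrthonormalFrame g U F ε) (hx : x ∈ U) :
    TangentSpace 𝓘(ℝ, E) x →ₗ[ℝ] TangentSpace 𝓘(ℝ, E) x →ₗ[ℝ] TangentSpace 𝓘(ℝ, E) x →ₗ[ℝ]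
      TangentSpace 𝓘(ℝ, E) x :=
  (h.basis hx).constr ℝ fun i ↦ (h.basis hx).constr ℝ fun j ↦ (h.basis hx).constr ℝ fun k ↦
    g.curvatureField (F i) (F j) (F k) x

lemma curvatureField_eq_curvatureMap [Nontrivial E] (h : IsOrthonormalFrame g U F ε) (hx : x ∈ U)
    (hX : SmoothField X x) (hY : SmoothField Y x) (hZ : SmoothField Z x) :
    g.curvatureField X Y Z x = h.curvatureMap hx (X x) (Y x) (Z x) := by
  have hF (i : ι) := h.smooth i x hx
  have e1 := h.expand hx (fun X ↦ g.curvatureField X Y Z x)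
    (fun _ _ h1 h2 e ↦ h.curvatureField_congr_left hx h1 h2 hZ e)
    (fun _ _ h1 h2 ↦ h.curvatureField_add_left hx h1 h2 hZ)
    (fun _ _ h1 h2 ↦ h.curvatureField_smul_left hx h1 h2 hZ) hX
  have e2 (i : ι) := h.expand hx (fun Y ↦ g.curvatureField (F i) Y Z x)
    (fun _ _ h1 h2 e ↦ by
      rw [curvatureField_swap, h.curvatureField_congr_left hx h1 h2 hZ e, ← curvatureField_swap])
    (fun _ _ h1 h2 ↦ by
      rw [curvatureField_swap, h.curvatureField_add_left hx h1 h2 hZ, neg_add,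
        ← curvatureField_swap, ← curvatureField_swap])
    (fun _ _ h1 h2 ↦ by
      rw [curvatureField_swap, h.curvatureField_smul_left hx h1 h2 hZ, ← smul_neg,
        ← curvatureField_swap]) hY
  have e3 (i j : ι) := h.expand hx (fun Z ↦ g.curvatureField (F i) (F j) Z x)
    (fun _ _ h1 h2 e ↦ h.curvatureField_congr_right hx (hF i) (hF j) h1 h2 e)
    (fun _ _ h1 h2 ↦ h.curvatureField_add_right hx (hF i) (hF j) h1 h2)
    (fun _ _ h1 h2 ↦ h.curvatureField_smul_right hx h1 (hF i) (hF j) h2) hZ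
  rw [e1]
  simp only [e2, e3, curvatureMap, Module.Basis.constr_apply_fintype, LinearMap.sum_apply,
    LinearMap.smul_apply, Module.Basis.equivFun_apply, h.basis_repr]

/-- The curvature tensor is given by the curvature operator on smooth vector fields. -/
lemma curvature_apply [Nontrivial E] (h : IsOrthonormalFrame g U F ε) (hx : x ∈ U)
    (hX : SmoothField X x) (hY : SmoothField Y x) (hZ : SmoothField Z x) :
    g.curvature x (X x) (Y x) (Z x) = g.curvatureField X Y Z x := by
  rw [h.curvatureField_eq_curvatureMap hx hX hY hZ]
  -- The tensor is defined through extensions of a basis unrelated to the frame. These extensions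
  -- are smooth fields, so the frame formula evaluates the curvature operator on them and the two
  -- trilinear maps agree on that basis.
  have e : g.curvature x = h.curvatureMap hx := by
    refine (Module.finBasis ℝ (TangentSpace 𝓘(ℝ, E) x)).ext fun i ↦
      (Module.finBasis ℝ (TangentSpace 𝓘(ℝ, E) x)).ext fun j ↦
      (Module.finBasis ℝ (TangentSpace 𝓘(ℝ, E) x)).ext fun k ↦ ?_
    simp only [curvature, Module.Basis.constr_basis]
    rw [h.curvatureField_eq_curvatureMap hx (smoothField_extend _) (smoothField_extend _)
      (smoothField_extend _)]
    simp
  rw [e]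

end IsOrthonormalFrame

end Frames

end

section

/-! ### Smooth functions on an open set as an algebra with derivations -/

section Algebra

variable {E : Type*} [NormedAddCommGroup E] [NormedSpace ℝ E]
  {M : Type*} [TopologicalSpace M] [ChartedSpace E M]

variable (E) in
/-- The algebra of functions on `U` that are restrictions of functions smooth around `U`. -/
def smoothAlgebra (U : Set M) : Subalgebra ℝ (U → ℝ) where
  carrier := {a | ∃ f : M → ℝ, (∀ y ∈ U, SmoothFn (E := E) f y) ∧ ∀ u : U, f u = a u}
  mul_mem' := by
    rintro a b ⟨f, hf, ha⟩ ⟨f', hf', hb⟩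
    exact ⟨f * f', fun y hy ↦ (hf y hy).mul (hf' y hy), fun u ↦ by simp [ha, hb]⟩
  add_mem' := by
    rintro a b ⟨f, hf, ha⟩ ⟨f', hf', hb⟩
    exact ⟨f + f', fun y hy ↦ (hf y hy).add (hf' y hy), fun u ↦ by simp [ha, hb]⟩
  algebraMap_mem' r := ⟨fun _ ↦ r, fun _ _ ↦ smoothFn_const r, fun _ ↦ rfl⟩

/-- The restriction to `U` of a function that is smooth around `U`. -/
def restrict {U : Set M} (f : M → ℝ) (hf : ∀ y ∈ U, SmoothFn (E := E) f y) : smoothAlgebra E U :=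
  ⟨fun u ↦ f u, f, hf, fun _ ↦ rfl⟩

@[simp] lemma restrict_val {U : Set M} (f : M → ℝ) (hf : ∀ y ∈ U, SmoothFn (E := E) f y) (u : U) :
    (restrict f hf).1 u = f u := rfl

lemma smoothAlgebra_ext {U : Set M} {a b : smoothAlgebra E U} (h : ∀ u : U, a.1 u = b.1 u) :
    a = b :=
  Subtype.ext (funext h)

variable [IsManifold 𝓘(ℝ, E) ∞ M] {U : Set M} {X : ∀ x : M, TangentSpace 𝓘(ℝ, E) x}

lemma dirDeriv_eq_of_eqOn (hU : IsOpen U) {f f' : M → ℝ} (h : ∀ u : U, f u = f' u) (u : U) :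
    dirDeriv X f u = dirDeriv X f' u := by
  apply dirDeriv_congr
  filter_upwards [hU.mem_nhds u.2] with y hy using h ⟨y, hy⟩

/-- The derivation of the algebra of smooth functions on `U` given by a smooth vector field. -/
def derivation (hU : IsOpen U) (X : ∀ x : M, TangentSpace 𝓘(ℝ, E) x)
    (hX : ∀ y ∈ U, SmoothField X y) : Derivation ℝ (smoothAlgebra E U) (smoothAlgebra E U) :=
  Derivation.mk'
    -- The chosen extension does not matter: since U is open, two extensions agree near each point
    -- of U.
    { toFun := fun a ↦ restrict (dirDeriv X a.2.choose)
        fun y hy ↦ (hX y hy).dirDeriv (a.2.choose_spec.1 y hy)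
      map_add' := fun a b ↦ smoothAlgebra_ext fun u ↦ by
        have h1 := a.2.choose_spec
        have h2 := b.2.choose_spec
        change dirDeriv X (a + b).2.choose u = dirDeriv X a.2.choose u + dirDeriv X b.2.choose u
        rw [← dirDeriv_add X (h1.1 u u.2).mdifferentiableAt (h2.1 u u.2).mdifferentiableAt]
        refine dirDeriv_eq_of_eqOn hU (fun v ↦ ?_) u
        rw [(a + b).2.choose_spec.2, Pi.add_apply, h1.2, h2.2]
        rfl
      map_smul' := fun r a ↦ smoothAlgebra_ext fun u ↦ by
        have h1 := a.2.choose_spec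
        change dirDeriv X (r • a).2.choose u = r * dirDeriv X a.2.choose u
        have e : dirDeriv X ((fun _ ↦ r) * a.2.choose) u = r * dirDeriv X a.2.choose u := by
          rw [dirDeriv_mul X (smoothFn_const r).mdifferentiableAt
            (h1.1 u u.2).mdifferentiableAt, dirDeriv_const]
          ring
        rw [← e]
        refine dirDeriv_eq_of_eqOn hU (fun v ↦ ?_) u
        rw [(r • a).2.choose_spec.2, Pi.mul_apply, h1.2]
        rfl }
    fun a b ↦ smoothAlgebra_ext fun u ↦ by
      have h1 := a.2.choose_spec
      have h2 := b.2.choose_spec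
      change dirDeriv X (a * b).2.choose u
        = a.1 u * dirDeriv X b.2.choose u + b.1 u * dirDeriv X a.2.choose u
      have e := dirDeriv_mul X (h1.1 u u.2).mdifferentiableAt (h2.1 u u.2).mdifferentiableAt
      rw [h1.2 u, h2.2 u, mul_comm (dirDeriv X _ _)] at e
      rw [← e]
      refine dirDeriv_eq_of_eqOn hU (fun v ↦ ?_) u
      rw [(a * b).2.choose_spec.2, Pi.mul_apply, h1.2, h2.2]
      rfl

lemma derivation_val (hU : IsOpen U) (hX : ∀ y ∈ U, SmoothField X y) {a : smoothAlgebra E U}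
    {f : M → ℝ} (h : ∀ u : U, f u = a.1 u) (u : U) :
    (derivation hU X hX a).1 u = dirDeriv X f u :=
  dirDeriv_eq_of_eqOn hU (fun v ↦ by rw [a.2.choose_spec.2, h]) u

lemma derivation_restrict (hU : IsOpen U) (hX : ∀ y ∈ U, SmoothField X y) (f : M → ℝ)
    (hf : ∀ y ∈ U, SmoothFn (E := E) f y) :
    derivation hU X hX (restrict f hf)
      = restrict (dirDeriv X f) fun y hy ↦ (hX y hy).dirDeriv (hf y hy) :=
  smoothAlgebra_ext fun u ↦ derivation_val hU hX (fun _ ↦ rfl) u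

lemma exists_eq_restrict (a : smoothAlgebra E U) :
    ∃ (f : M → ℝ) (hf : ∀ y ∈ U, SmoothFn (E := E) f y), a = restrict f hf :=
  ⟨_, a.2.choose_spec.1, smoothAlgebra_ext fun u ↦ (a.2.choose_spec.2 u).symm⟩

end Algebra

/-! ### Structure functions, connection coefficients and curvature components of a frame -/

namespace IsOrthonormalFrame

variable {E : Type*} [NormedAddCommGroup E] [NormedSpace ℝ E] [FiniteDimensional ℝ E]
  {M : Type*} [TopologicalSpace M] [ChartedSpace E M] [IsManifold 𝓘(ℝ, E) ∞ M]
  {g : PseudoRiemannianMetric E M} {x : M}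
  {ι : Type*} [Fintype ι] [DecidableEq ι] {U : Set M}
  {F : ι → ∀ x : M, TangentSpace 𝓘(ℝ, E) x} {ε : ι → ℝ}

/-- The derivation along a field of the frame. -/
def D (h : IsOrthonormalFrame g U F ε) (i : ι) :
    Derivation ℝ (smoothAlgebra E U) (smoothAlgebra E U) :=
  derivation h.isOpen (F i) (h.smooth i)

/-- The structure functions of the frame, `g([F i, F j], F k)`. -/
def c (h : IsOrthonormalFrame g U F ε) (i j k : ι) : smoothAlgebra E U :=
  restrict (g.fn (mlieBracket 𝓘(ℝ, E) (F i) (F j)) (F k)) fun y hy ↦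
    have : CompleteSpace E := FiniteDimensional.complete ℝ E
    smoothFn_fn ((h.smooth i y hy).mlieBracket (h.smooth j y hy)) (h.smooth k y hy)

/-- The connection coefficients of the frame, `g(∇_{F i} F j, F k)`. -/
def Γ (h : IsOrthonormalFrame g U F ε) (i j k : ι) : smoothAlgebra E U :=
  restrict (g.fn (fun y ↦ g.leviCivita (F j) y (F i y)) (F k)) fun y hy ↦
    smoothFn_fn (h.smoothField_leviCivita hy (h.smooth i y hy) (h.smooth j y hy)) (h.smooth k y hy)

lemma c_swap (h : IsOrthonormalFrame g U F ε) (i j k : ι) : h.c j i k = -h.c i j k :=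
  smoothAlgebra_ext fun u ↦ by
    change g.inner u (mlieBracket 𝓘(ℝ, E) (F j) (F i) u) (F k u)
      = -g.inner u (mlieBracket 𝓘(ℝ, E) (F i) (F j) u) (F k u)
    rw [mlieBracket_swap_apply]
    simp

lemma dirDeriv_fn (h : IsOrthonormalFrame g U F ε) (hx : x ∈ U) (i j : ι)
    (X : ∀ x : M, TangentSpace 𝓘(ℝ, E) x) : dirDeriv X (g.fn (F i) (F j)) x = 0 := by
  rw [dirDeriv_congr (f' := fun _ ↦ if i = j then ε i else 0), dirDeriv_const]
  filter_upwards [h.isOpen.mem_nhds hx] with y hy using h.inner_eq i j y hy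

/-- In Koszul's formula the derivatives of the metric drop out, because the frame has constant inner
products. -/
lemma two_mul_Γ (h : IsOrthonormalFrame g U F ε) (i j k : ι) :
    2 * h.Γ i j k = h.c i j k - h.c j k i + h.c k i j :=
  smoothAlgebra_ext fun u ↦ by
    change 2 * g.inner u (g.nabla (F j) u (F i u)) (F k u)
      = g.inner u (mlieBracket 𝓘(ℝ, E) (F i) (F j) u) (F k u)
        - g.inner u (mlieBracket 𝓘(ℝ, E) (F j) (F k) u) (F i u)
        + g.inner u (mlieBracket 𝓘(ℝ, E) (F k) (F i) u) (F j u)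
    rw [g.inner_nabla (h.smooth i u u.2).diffAt (h.smooth j u u.2).diffAt
      (h.smooth k u u.2).diffAt, koszul, h.dirDeriv_fn u.2, h.dirDeriv_fn u.2, h.dirDeriv_fn u.2]
    ring

lemma Γ_swap (h : IsOrthonormalFrame g U F ε) (i j k : ι) : h.Γ i k j = -h.Γ i j k :=
  smoothAlgebra_ext fun u ↦ by
    change g.inner u (g.leviCivita (F k) u (F i u)) (F j u)
      = -g.inner u (g.leviCivita (F j) u (F i u)) (F k u)
    have := g.leviCivita_metric (h.smooth i u u.2).diffAt (h.smooth j u u.2).diffAt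
      (h.smooth k u u.2).diffAt
    rw [h.dirDeriv_fn u.2, g.symm u (F j u)] at this
    linarith

lemma D_comm [Nontrivial E] (h : IsOrthonormalFrame g U F ε) (i j : ι) (a : smoothAlgebra E U) :
    h.D i (h.D j a) - h.D j (h.D i a) = ∑ m, ε m • (h.c i j m * h.D m a) := by
  have : CompleteSpace E := FiniteDimensional.complete ℝ E
  obtain ⟨f, hf, rfl⟩ := exists_eq_restrict a
  simp only [D, derivation_restrict]
  refine smoothAlgebra_ext fun u ↦ ?_
  have e := dirDeriv_mlieBracket (h.smooth i u u.2) (h.smooth j u u.2) (hf u u.2)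
  change dirDeriv (F i) (dirDeriv (F j) f) u - dirDeriv (F j) (dirDeriv (F i) f) u = _
  rw [← e, dirDeriv, h.eq_sum u.2 (mlieBracket 𝓘(ℝ, E) (F i) (F j) u)]
  simp [dirDeriv, c, fn, mul_assoc]

/-- The coefficients of `[F i, W]`. -/
lemma inner_mlieBracket (h : IsOrthonormalFrame g U F ε) (u : U)
    {W : ∀ x : M, TangentSpace 𝓘(ℝ, E) x} (hW : SmoothField W u) (i l : ι) :
    g.inner u (mlieBracket 𝓘(ℝ, E) (F i) W u) (F l u)
      = dirDeriv (F i) (g.fn W (F l)) u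
        + ∑ m, ε m * (g.inner u (W u) (F m u) * (h.c i m l).1 u) := by
  have hF (i : ι) := (h.smooth i u u.2).diffAt
  have e1 := g.leviCivita_metric (hF i) hW.diffAt (hF l)
  have e2 (m : ι) : (h.c i m l).1 u = -g.inner u (F m u) (g.leviCivita (F l) u (F i u))
      - g.inner u (g.leviCivita (F i) u (F m u)) (F l u) := by
    have e3 := g.leviCivita_metric (hF i) (hF m) (hF l)
    rw [h.dirDeriv_fn u.2] at e3
    change g.inner u (mlieBracket 𝓘(ℝ, E) (F i) (F m) u) (F l u) = _
    rw [← g.leviCivita_torsion (hF i) (hF m), map_sub, sub_apply]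
    linarith
  -- Metric compatibility and vanishing torsion leave only terms linear in the value W u, so W can
  -- be expanded in the frame at u without differentiating its coefficients.
  have e4 : ∑ m, ε m * (g.inner u (W u) (F m u) * (h.c i m l).1 u)
      = -g.inner u (W u) (g.leviCivita (F l) u (F i u))
        - g.inner u (g.leviCivita (F i) u (W u)) (F l u) := by
    conv_rhs => rw [h.eq_sum u.2 (W u)]
    simp only [e2, map_sum, map_smul, sum_apply, smul_apply, smul_eq_mul,
      ← Finset.sum_neg_distrib, ← Finset.sum_sub_distrib]
    exact Finset.sum_congr rfl fun m _ ↦ by ring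
  rw [e4, ← g.leviCivita_torsion (hF i) hW.diffAt, map_sub, sub_apply]
  linarith

/-- Each of the three summands is the F l-component of a double bracket [F i, [F j, F k]],
cyclically permuted. -/
lemma c_jacobi (h : IsOrthonormalFrame g U F ε) (i j k l : ι) :
    h.D i (h.c j k l) + (∑ m, ε m • (h.c j k m * h.c i m l))
      + (h.D j (h.c k i l) + ∑ m, ε m • (h.c k i m * h.c j m l))
      + (h.D k (h.c i j l) + ∑ m, ε m • (h.c i j m * h.c k m l)) = 0 := by
  have : CompleteSpace E := FiniteDimensional.complete ℝ E
  have e (i j k : ι) (u : U) :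
      (h.D i (h.c j k l) + ∑ m, ε m • (h.c j k m * h.c i m l)).1 u
        = g.inner u (mlieBracket 𝓘(ℝ, E) (F i) (mlieBracket 𝓘(ℝ, E) (F j) (F k)) u) (F l u) := by
    rw [h.inner_mlieBracket u ((h.smooth j u u.2).mlieBracket (h.smooth k u u.2)), D, c,
      derivation_restrict]
    simp [c, fn]
  refine smoothAlgebra_ext fun u ↦ ?_
  have e' := congrArg (fun v ↦ g.inner u v (F l u))
    (jacobi (h.smooth i u u.2) (h.smooth j u u.2) (h.smooth k u u.2))
  simp only [map_add, add_apply] at e'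
  have e2 : mlieBracket 𝓘(ℝ, E) (F j) (mlieBracket 𝓘(ℝ, E) (F i) (F k)) u
      = (-1 : ℝ) • mlieBracket 𝓘(ℝ, E) (F j) (mlieBracket 𝓘(ℝ, E) (F k) (F i)) u := by
    rw [mlieBracket_swap (V := F i) (W := F k), ← neg_one_smul ℝ,
      mlieBracket_const_smul_right ((h.smooth k u u.2).mlieBracket (h.smooth i u u.2)).diffAt]
  rw [mlieBracket_swap_apply (V := mlieBracket 𝓘(ℝ, E) (F i) (F j)), e2] at e'
  change (h.D i (h.c j k l) + ∑ m, ε m • (h.c j k m * h.c i m l)).1 u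
    + (h.D j (h.c k i l) + ∑ m, ε m • (h.c k i m * h.c j m l)).1 u
    + (h.D k (h.c i j l) + ∑ m, ε m • (h.c i j m * h.c k m l)).1 u = 0
  rw [e, e, e]
  simp at e'
  linarith

/-- The components of the curvature tensor in terms of the connection coefficients. -/
def R (h : IsOrthonormalFrame g U F ε) (i j k l : ι) : smoothAlgebra E U :=
  h.D i (h.Γ j k l) - h.D j (h.Γ i k l)
    + ∑ m, ε m • (h.Γ i k m * h.Γ j l m - h.Γ j k m * h.Γ i l m - h.c i j m * h.Γ m k l)

/-- Metric compatibility turns g(∇_{F i} ∇_{F j} F k, F l) into the derivative of a connection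
coefficient minus a product of two covariant derivatives, which is expanded in the frame. -/
lemma inner_curvature [Nontrivial E] (h : IsOrthonormalFrame g U F ε) (u : U) (i j k l : ι) :
    g.inner u (g.curvature u (F i u) (F j u) (F k u)) (F l u) = (h.R i j k l).1 u := by
  have hF (i : ι) := h.smooth i u u.2
  have key (i j : ι) : g.inner u (g.leviCivita (fun y ↦ g.leviCivita (F k) y (F j y)) u (F i u))
      (F l u) = (h.D i (h.Γ j k l)).1 u - ∑ m, ε m * ((h.Γ j k m).1 u * (h.Γ i l m).1 u) := by
    have e := g.leviCivita_metric (hF i).diffAt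
      (h.smoothField_leviCivita u.2 (hF j) (hF k)).diffAt (hF l).diffAt
    rw [h.inner_eq_sum u.2 (g.leviCivita (F k) u (F j u))] at e
    rw [D, Γ, derivation_restrict]
    exact (eq_sub_of_add_eq e.symm)
  have e3 : g.inner u (g.leviCivita (F k) u (mlieBracket 𝓘(ℝ, E) (F i) (F j) u)) (F l u)
      = ∑ m, ε m * ((h.c i j m).1 u * (h.Γ m k l).1 u) := by
    rw [h.eq_sum u.2 (mlieBracket 𝓘(ℝ, E) (F i) (F j) u)]
    simp only [map_sum, map_smul, sum_apply, smul_apply, smul_eq_mul, mul_assoc]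
    rfl
  rw [h.curvature_apply u.2 (hF i) (hF j) (hF k), curvatureField, map_sub, map_sub, sub_apply,
    sub_apply, key, key, e3, R]
  simp [mul_sub, Finset.sum_sub_distrib]
  ring

end IsOrthonormalFrame

end

section

/-! ### Differential algebra of the structure equations -/

section Derivations

variable {A : Type*} [CommRing A] [Algebra ℝ A]

lemma eq_of_two_mul_eq {a b : A} (h : 2 * a = 2 * b) : a = b := by
  have e (c : A) : c = (1 / 2 : ℝ) • (2 * c) := by
    rw [two_mul, ← two_smul ℝ c, smul_smul]
    norm_num
  rw [e a, h, ← e b]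

variable {D₀ D₁ D₂ : Derivation ℝ A A} {p μ τ α β : A}

/-- The two Codazzi quantities of an `h`-operator with `∇_ξ h = 0` satisfy a linear system with
determinant `μ ^ 2 - p ^ 2`. -/
lemma codazzi_system
    (comm₀₁ : ∀ a, D₀ (D₁ a) - D₁ (D₀ a) = p * D₁ a + (τ - μ) * D₂ a)
    (comm₀₂ : ∀ a, D₀ (D₂ a) - D₂ (D₀ a) = (τ + μ) * D₁ a - p * D₂ a)
    (jac₁ : D₀ α + α * p + β * (τ + μ) - D₁ (τ + μ) + D₂ p = 0)
    (jac₂ : D₀ β + α * (τ - μ) - β * p + D₁ p + D₂ (τ - μ) = 0)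
    (h0p : D₀ p = -2 * ((1 - τ) * μ)) (h0μ : D₀ μ = -2 * ((1 - τ) * p))
    (ha : D₂ p = D₁ μ - 2 * (α * p) - 2 * (β * μ))
    (hb : D₂ μ = D₁ p - 2 * (α * μ) - 2 * (β * p)) :
    p * (D₁ μ - 2 * (α * p)) = μ * (D₁ p - 2 * (α * μ)) ∧
      μ * (D₁ μ - 2 * (α * p)) = p * (D₁ p - 2 * (α * μ)) := by
  have two (D : Derivation ℝ A A) (a : A) : D (2 * a) = 2 * D a := by
    rw [two_mul, map_add, two_mul]
  have two' (D : Derivation ℝ A A) (a : A) : D (-2 * a) = -2 * D a := by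
    rw [neg_mul, map_neg, two, neg_mul]
  -- By `ha` and `hb`, D₀ (D₁ μ) occurs in both `c1` and `c4`, and D₀ (D₁ p) in both `c2` and `c3`.
  -- The differences eliminate these second derivatives; `jac₁` and `jac₂` then remove the
  -- derivatives of α, β and τ.
  have c1 := comm₀₁ μ
  have c2 := comm₀₁ p
  have c3 := comm₀₂ μ
  have c4 := comm₀₂ p
  simp only [h0p, h0μ, ha, hb, map_sub, map_add, two, two', Derivation.leibniz, smul_eq_mul,
    Derivation.map_one_eq_zero] at c1 c2 c3 c4 jac₁ jac₂
  constructor <;> apply eq_of_two_mul_eq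
  · linear_combination -c1 + c4 + 2 * p * jac₁ + 2 * μ * jac₂
  · linear_combination c2 - c3 - 2 * μ * jac₁ - 2 * p * jac₂

/-- With a = D₁ μ - 2αp and b = D₁ p - 2αμ, the derivatives of μ² - p² along D₁ and D₂ are 2(μa -
pb) and 2(μb - pa), which vanish by `codazzi_system`. Along D₀ the two contributions cancel by `h0p`
and `h0μ`. -/
lemma derivation_det_eq_zero
    (comm₀₁ : ∀ a, D₀ (D₁ a) - D₁ (D₀ a) = p * D₁ a + (τ - μ) * D₂ a)
    (comm₀₂ : ∀ a, D₀ (D₂ a) - D₂ (D₀ a) = (τ + μ) * D₁ a - p * D₂ a)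
    (jac₁ : D₀ α + α * p + β * (τ + μ) - D₁ (τ + μ) + D₂ p = 0)
    (jac₂ : D₀ β + α * (τ - μ) - β * p + D₁ p + D₂ (τ - μ) = 0)
    (h0p : D₀ p = -2 * ((1 - τ) * μ)) (h0μ : D₀ μ = -2 * ((1 - τ) * p))
    (ha : D₂ p = D₁ μ - 2 * (α * p) - 2 * (β * μ))
    (hb : D₂ μ = D₁ p - 2 * (α * μ) - 2 * (β * p)) :
    D₀ (μ * μ - p * p) = 0 ∧ D₁ (μ * μ - p * p) = 0 ∧ D₂ (μ * μ - p * p) = 0 := by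
  obtain ⟨e1, e2⟩ := codazzi_system comm₀₁ comm₀₂ jac₁ jac₂ h0p h0μ ha hb
  simp only [map_sub, Derivation.leibniz, smul_eq_mul, h0p, h0μ, ha, hb]
  refine ⟨?_, ?_, ?_⟩
  · ring
  · linear_combination 2 * e2
  · linear_combination -2 * e1

/-- The vanishing expression is dθ(e, φe) (without the factor 1/2) for the connection form θ of ker
η, with θ(ξ) = 1 - τ, θ(e) = -α, θ(φe) = β. Once μ² - p² is a unit, dμ = -2pθ and dp = -2μθ, and
integrability of this system forces the vanishing. -/
lemma curvature_form_eq_zero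
    (comm₀₁ : ∀ a, D₀ (D₁ a) - D₁ (D₀ a) = p * D₁ a + (τ - μ) * D₂ a)
    (comm₀₂ : ∀ a, D₀ (D₂ a) - D₂ (D₀ a) = (τ + μ) * D₁ a - p * D₂ a)
    (comm₁₂ : ∀ a, D₁ (D₂ a) - D₂ (D₁ a) = α * D₁ a + β * D₂ a - 2 * D₀ a)
    (jac₁ : D₀ α + α * p + β * (τ + μ) - D₁ (τ + μ) + D₂ p = 0)
    (jac₂ : D₀ β + α * (τ - μ) - β * p + D₁ p + D₂ (τ - μ) = 0)
    (h0p : D₀ p = -2 * ((1 - τ) * μ)) (h0μ : D₀ μ = -2 * ((1 - τ) * p))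
    (ha : D₂ p = D₁ μ - 2 * (α * p) - 2 * (β * μ))
    (hb : D₂ μ = D₁ p - 2 * (α * μ) - 2 * (β * p)) (hu : IsUnit (μ * μ - p * p)) :
    D₁ β + D₂ α + α * α - β * β + 2 * (1 - τ) = 0 := by
  obtain ⟨e1, e2⟩ := codazzi_system comm₀₁ comm₀₂ jac₁ jac₂ h0p h0μ ha hb
  -- Cramer's rule for the homogeneous Codazzi system, whose determinant is a unit.
  have a0 : D₁ μ = 2 * (α * p) := by
    rw [← sub_eq_zero, ← hu.mul_right_eq_zero]
    linear_combination μ * e2 - p * e1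
  have b0 : D₁ p = 2 * (α * μ) := by
    rw [← sub_eq_zero, ← hu.mul_right_eq_zero]
    linear_combination p * e2 - μ * e1
  have two (D : Derivation ℝ A A) (a : A) : D (2 * a) = 2 * D a := by
    rw [two_mul, map_add, two_mul]
  -- Up to a factor -2, these say that p and μ respectively annihilate the curvature expression.
  -- Combining them with weights p and μ brings out the unit μ² - p².
  have c1 := comm₁₂ μ
  have c2 := comm₁₂ p
  simp only [hb, ha, a0, b0, h0p, h0μ, map_sub, two, Derivation.leibniz, smul_eq_mul] at c1 c2
  rw [← hu.mul_right_eq_zero]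
  apply eq_of_two_mul_eq
  linear_combination p * c1 - μ * c2

end Derivations

end

section

/-! ### Curvature of an adapted frame -/

namespace IsOrthonormalFrame

variable {E : Type*} [NormedAddCommGroup E] [NormedSpace ℝ E] [FiniteDimensional ℝ E]
  {M : Type*} [TopologicalSpace M] [ChartedSpace E M] [IsManifold 𝓘(ℝ, E) ∞ M]
  {g : PseudoRiemannianMetric E M} {x : M}

section Symmetries

variable {ι : Type*} [Fintype ι] [DecidableEq ι] {U : Set M}
  {F : ι → ∀ x : M, TangentSpace 𝓘(ℝ, E) x} {ε : ι → ℝ}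

lemma c_self (h : IsOrthonormalFrame g U F ε) (i k : ι) : h.c i i k = 0 := by
  apply eq_of_two_mul_eq
  linear_combination h.c_swap i i k

lemma Γ_self (h : IsOrthonormalFrame g U F ε) (i k : ι) : h.Γ i k k = 0 := by
  apply eq_of_two_mul_eq
  linear_combination h.Γ_swap i k k

lemma R_swap_left (h : IsOrthonormalFrame g U F ε) (i j k l : ι) : h.R j i k l = -h.R i j k l := by
  have e (m : ι) : ε m • (h.Γ j k m * h.Γ i l m - h.Γ i k m * h.Γ j l m - h.c j i m * h.Γ m k l)
      = -(ε m • (h.Γ i k m * h.Γ j l m - h.Γ j k m * h.Γ i l m - h.c i j m * h.Γ m k l)) := by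
    rw [h.c_swap i j, ← smul_neg]
    congr 1
    ring
  simp only [R, e, Finset.sum_neg_distrib]
  ring

lemma R_swap_right (h : IsOrthonormalFrame g U F ε) (i j k l : ι) :
    h.R i j l k = -h.R i j k l := by
  have e (m : ι) : ε m • (h.Γ i l m * h.Γ j k m - h.Γ j l m * h.Γ i k m - h.c i j m * h.Γ m l k)
      = -(ε m • (h.Γ i k m * h.Γ j l m - h.Γ j k m * h.Γ i l m - h.c i j m * h.Γ m k l)) := by
    rw [h.Γ_swap m k l, ← smul_neg]
    congr 1
    ring
  rw [R, Finset.sum_congr rfl fun m _ ↦ e m, Finset.sum_neg_distrib, h.Γ_swap j k l,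
    h.Γ_swap i k l, map_neg, map_neg, R]
  ring

lemma R_self_left (h : IsOrthonormalFrame g U F ε) (i k l : ι) : h.R i i k l = 0 := by
  apply eq_of_two_mul_eq
  linear_combination h.R_swap_left i i k l

lemma R_self_right (h : IsOrthonormalFrame g U F ε) (i j k : ι) : h.R i j k k = 0 := by
  apply eq_of_two_mul_eq
  linear_combination h.R_swap_right i j k k

end Symmetries

variable {U : Set M} {F : Fin 3 → ∀ x : M, TangentSpace 𝓘(ℝ, E) x}

/-- The structure functions of a frame `(ξ, e, φ e)` of a paracontact metric structure. -/
structure IsAdapted (h : IsOrthonormalFrame g U F ![1, 1, -1]) (p μ τ α β : smoothAlgebra E U) :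
    Prop where
  c010 : h.c 0 1 0 = 0
  c011 : h.c 0 1 1 = p
  c012 : h.c 0 1 2 = -(τ - μ)
  c020 : h.c 0 2 0 = 0
  c021 : h.c 0 2 1 = τ + μ
  c022 : h.c 0 2 2 = p
  c120 : h.c 1 2 0 = -2
  c121 : h.c 1 2 1 = α
  c122 : h.c 1 2 2 = -β

namespace IsAdapted

variable {h : IsOrthonormalFrame g U F ![1, 1, -1]} {p μ τ α β : smoothAlgebra E U}

/-- The coefficients with middle index 0 encode ∇_X ξ = -φX + φhX; those ending in 1 2 are the
connection form of ker η, with values 1 - τ, -α, β on ξ, e, φe. -/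
lemma Γ_eq (H : h.IsAdapted p μ τ α β) :
    h.Γ 0 0 1 = 0 ∧ h.Γ 0 0 2 = 0 ∧ h.Γ 0 1 2 = 1 - τ ∧
    h.Γ 1 0 1 = -p ∧ h.Γ 1 0 2 = 1 - μ ∧ h.Γ 1 1 2 = -α ∧
    h.Γ 2 0 1 = -1 - μ ∧ h.Γ 2 0 2 = -p ∧ h.Γ 2 1 2 = β := by
  refine ⟨?_, ?_, ?_, ?_, ?_, ?_, ?_, ?_, ?_⟩ <;> apply eq_of_two_mul_eq <;>
    rw [two_mul_Γ] <;>
    simp only [h.c_self, h.c_swap 0 1, h.c_swap 0 2, h.c_swap 1 2, H.c010, H.c011, H.c012, H.c020,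
      H.c021, H.c022, H.c120, H.c121, H.c122] <;> ring

/-- This is the e-component of the Jacobi identity for (ξ, e, φe); `jacobi₂` is the φe-component.
The ξ-component is what makes `c011` and `c022` equal. -/
lemma jacobi₁ (H : h.IsAdapted p μ τ α β) :
    h.D 0 α + α * p + β * (τ + μ) - h.D 1 (τ + μ) + h.D 2 p = 0 := by
  have := h.c_jacobi 0 1 2 1
  simp [Fin.sum_univ_three, h.c_self, h.c_swap 0 1, h.c_swap 0 2, h.c_swap 1 2, H.c010, H.c011,
    H.c012, H.c020, H.c021, H.c022, H.c120, H.c121, H.c122] at this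
  simp only [map_add]
  linear_combination this

lemma jacobi₂ (H : h.IsAdapted p μ τ α β) :
    h.D 0 β + α * (τ - μ) - β * p + h.D 1 p + h.D 2 (τ - μ) = 0 := by
  have := h.c_jacobi 0 1 2 2
  simp [Fin.sum_univ_three, h.c_self, h.c_swap 0 1, h.c_swap 0 2, h.c_swap 1 2, H.c010, H.c011,
    H.c012, H.c020, H.c021, H.c022, H.c120, H.c121, H.c122] at this
  simp only [map_sub]
  linear_combination -this

lemma comm₀₁ [Nontrivial E] (H : h.IsAdapted p μ τ α β) (a : smoothAlgebra E U) :
    h.D 0 (h.D 1 a) - h.D 1 (h.D 0 a) = p * h.D 1 a + (τ - μ) * h.D 2 a := by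
  rw [h.D_comm]
  simp [Fin.sum_univ_three, H.c010, H.c011, H.c012]
  ring

lemma comm₀₂ [Nontrivial E] (H : h.IsAdapted p μ τ α β) (a : smoothAlgebra E U) :
    h.D 0 (h.D 2 a) - h.D 2 (h.D 0 a) = (τ + μ) * h.D 1 a - p * h.D 2 a := by
  rw [h.D_comm]
  simp [Fin.sum_univ_three, H.c020, H.c021, H.c022]
  ring

lemma comm₁₂ [Nontrivial E] (H : h.IsAdapted p μ τ α β) (a : smoothAlgebra E U) :
    h.D 1 (h.D 2 a) - h.D 2 (h.D 1 a) = α * h.D 1 a + β * h.D 2 a - 2 * h.D 0 a := by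
  rw [h.D_comm]
  simp [Fin.sum_univ_three, H.c120, H.c121, H.c122]
  ring

/-- The curvature components in an adapted frame. -/
lemma R_eq (H : h.IsAdapted p μ τ α β) :
    h.R 0 1 0 1 = -(h.D 0 p + 2 * ((1 - τ) * μ)) - (μ * μ - p * p - 1) ∧
    h.R 0 2 0 2 = -(h.D 0 p + 2 * ((1 - τ) * μ)) + (μ * μ - p * p - 1) ∧
    h.R 0 1 0 2 = -(h.D 0 μ + 2 * ((1 - τ) * p)) ∧
    h.R 0 2 0 1 = -(h.D 0 μ + 2 * ((1 - τ) * p)) ∧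
    h.R 1 2 0 1 = -h.D 1 μ + h.D 2 p + 2 * (α * p) + 2 * (β * μ) ∧
    h.R 1 2 0 2 = -h.D 1 p + h.D 2 μ + 2 * (α * μ) + 2 * (β * p) ∧
    h.R 0 1 1 2 = h.R 1 2 0 1 ∧
    h.R 0 2 1 2 = h.R 1 2 0 2 ∧
    h.R 1 2 1 2 = (h.D 1 β + h.D 2 α + α * α - β * β + 2 * (1 - τ)) - (μ * μ - p * p - 1) := by
  obtain ⟨e1, e2, e3, e4, e5, e6, e7, e8, e9⟩ := H.Γ_eq
  -- The Jacobi components are needed only for the pair symmetries `R 0 1 1 2 = R 1 2 0 1` and `R 0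
  -- 2 1 2 = R 1 2 0 2`. In the other formulas, D₀ p + 2(1 - τ)μ and D₀ μ + 2(1 - τ)p are the
  -- components of ∇'_ξ h, and the last one is the Gauss equation for ker η.
  have j1 := H.jacobi₁
  have j2 := H.jacobi₂
  simp only [map_add, map_sub] at j1 j2
  refine ⟨?_, ?_, ?_, ?_, ?_, ?_, ?_, ?_, ?_⟩ <;>
    simp only [R, Fin.sum_univ_three, H.c010, H.c011, H.c012, H.c020, H.c021, H.c022,
      H.c120, H.c121, H.c122, h.Γ_self, h.Γ_swap _ 0 1, h.Γ_swap _ 0 2, h.Γ_swap _ 1 2, e1, e2, e3,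
      e4, e5, e6, e7, e8, e9, Matrix.cons_val_zero, Matrix.cons_val_one, Matrix.cons_val_two,
      Matrix.head_cons, Matrix.tail_cons, one_smul, neg_smul, map_neg, map_sub,
      Derivation.map_one_eq_zero, map_zero]
  · ring
  · ring
  · ring
  · ring
  · ring
  · ring
  · linear_combination -j1
  · linear_combination j2
  · ring

end IsAdapted

end IsOrthonormalFrame

end

/-! ### Paracontact algebra and existence of adapted frames -/

section

variable {E : Type*} [NormedAddCommGroup E] [NormedSpace ℝ E]
  {M : Type*} [TopologicalSpace M] [ChartedSpace E M] [IsManifold 𝓘(ℝ, E) ∞ M]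

lemma extDeriv_swap (η : ∀ x : M, TangentSpace 𝓘(ℝ, E) x →L[ℝ] ℝ)
    (X Y : ∀ x : M, TangentSpace 𝓘(ℝ, E) x) (x : M) : extDeriv η X Y x = -extDeriv η Y X x := by
  rw [extDeriv, extDeriv, mlieBracket_swap_apply, map_neg]
  ring

namespace ParacontactMetricStructure

variable (S : ParacontactMetricStructure E M) (x : M)

/-- Skewness of φ is the skewness of dη, tested on extensions of v and w. -/
lemma inner_φ_swap (v w : TangentSpace 𝓘(ℝ, E) x) :
    S.g.inner x v (S.φ x w) = -S.g.inner x w (S.φ x v) := by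
  have hv := (smoothField_extend v).diffAt
  have hw := (smoothField_extend w).diffAt
  have h1 := S.extDeriv_eq x _ _ hv hw
  have h2 := S.extDeriv_eq x _ _ hw hv
  rw [extDeriv_swap, h2] at h1
  simpa using h1.symm

/-- Compute φ³ξ in two ways: it is 0 because φ²ξ = 0, and it is φξ - η(φξ)ξ, where η(φξ) = 0 by
skewness. -/
lemma φ_ξ : S.φ x (S.ξ x) = 0 := by
  have h1 : S.φ x (S.φ x (S.ξ x)) = 0 := by simp [S.φ_sq, S.η_ξ]
  have h2 := S.φ_sq x (S.φ x (S.ξ x))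
  have h3 := S.inner_φ_swap x (S.ξ x) (S.ξ x)
  have h4 : S.η x (S.φ x (S.ξ x)) = 0 := by
    rw [S.η_eq, S.g.symm]
    linarith
  rw [h1, h4, map_zero] at h2
  simpa using h2.symm

lemma η_φ (v : TangentSpace 𝓘(ℝ, E) x) : S.η x (S.φ x v) = 0 := by
  rw [S.η_eq, S.g.symm, S.inner_φ_swap, S.φ_ξ]
  simp

lemma inner_φ_φ (v w : TangentSpace 𝓘(ℝ, E) x) :
    S.g.inner x (S.φ x v) (S.φ x w) = -S.g.inner x v w + S.η x v * S.η x w := by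
  rw [S.inner_φ_swap, S.φ_sq, map_sub, map_smul, S.g.symm, ← S.η_eq, S.g.symm x v w]
  simp
  ring

lemma inner_ξ_ξ : S.g.inner x (S.ξ x) (S.ξ x) = 1 := by
  rw [← S.η_eq, S.η_ξ]

variable [FiniteDimensional ℝ E]

/-- On ker η the endomorphism φ reverses the sign of g, so without spacelike vectors there are no
timelike ones either. By polarization g then vanishes on ker η, and nondegeneracy makes η injective,
which is impossible in dimension 3. -/
lemma exists_spacelike (hE : Module.finrank ℝ E = 3) :
    ∃ v : TangentSpace 𝓘(ℝ, E) x, S.η x v = 0 ∧ 0 < S.g.inner x v v := by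
  by_contra! hv
  have h0 (v : TangentSpace 𝓘(ℝ, E) x) (h : S.η x v = 0) : S.g.inner x v v = 0 := by
    have h1 := hv v h
    have h2 := hv (S.φ x v) (S.η_φ x v)
    rw [S.inner_φ_φ, h] at h2
    linarith
  have h1 (v w : TangentSpace 𝓘(ℝ, E) x) (h : S.η x v = 0) (h' : S.η x w = 0) :
      S.g.inner x v w = 0 := by
    have := h0 (v + w) (by simp [h, h'])
    simp [h0 v h, h0 w h', S.g.symm x w v] at this
    linarith
  have hinj : Function.Injective (S.η x).toLinearMap := by
    rw [← LinearMap.ker_eq_bot, LinearMap.ker_eq_bot']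
    intro v h
    replace h : S.η x v = 0 := h
    refine S.g.nondegenerate x v fun w ↦ ?_
    have h2 := h1 v (w - S.η x w • S.ξ x) h (by simp [S.η_ξ])
    rw [map_sub, map_smul, ← S.η_eq, h] at h2
    simpa using h2
  have h2 := LinearMap.finrank_le_finrank_of_injective hinj
  have h3 : Module.finrank ℝ (TangentSpace 𝓘(ℝ, E) x) = 3 := hE
  rw [h3, Module.finrank_self] at h2
  omega

/-- Around each point there is a unit spacelike vector field orthogonal to `ξ`. -/
lemma exists_unit_field (hE : Module.finrank ℝ E = 3) :
    ∃ (U : Set M) (X : ∀ x : M, TangentSpace 𝓘(ℝ, E) x), IsOpen U ∧ x ∈ U ∧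
      ∀ y ∈ U, SmoothField X y ∧ S.η y (X y) = 0 ∧ S.g.inner y (X y) (X y) = 1 := by
  obtain ⟨v, hv, hpos⟩ := S.exists_spacelike x hE
  have hξ (y : M) : SmoothField S.ξ y := Eventually.of_forall S.contMDiff_ξ
  have hV := smoothField_extend v
  set V := FiberBundle.extend E v with hVdef
  have hV0 : V x = v := by simp [V]
  -- Subtract the ξ-component of the extension to land in ker η; at x nothing changes, so g(W, W)
  -- stays positive nearby and W can be normalised.
  set W : ∀ x : M, TangentSpace 𝓘(ℝ, E) x := V + ((fun _ ↦ -1) * S.g.fn V S.ξ) • S.ξ with hW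
  have hWs : SmoothField W x :=
    hV.add (SmoothField.smul ((smoothFn_const _).mul (smoothFn_fn hV (hξ x))) (hξ x))
  have hWη (y : M) : S.η y (W y) = 0 := by
    simp [hW, fn, S.η_eq, S.inner_ξ_ξ]
  have hW0 : W x = v := by
    rw [S.η_eq] at hv
    simp [hW, fn, hV0, hv]
  have hN := smoothFn_fn (g := S.g) hWs hWs
  have hNpos : ∀ᶠ y in 𝓝 x, 0 < S.g.fn W W y :=
    hN.self_of_nhds.continuousAt.eventually (lt_mem_nhds (by simpa [fn, hW0] using hpos))
  obtain ⟨U, hU, hUo, hxU⟩ := eventually_nhds_iff.1 (hNpos.and (hN.and hWs))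
  refine ⟨U, (fun y ↦ (√(S.g.fn W W y))⁻¹) • W, hUo, hxU, fun y hy ↦ ⟨?_, ?_, ?_⟩⟩
  · filter_upwards [hUo.mem_nhds hy] with z hz
    obtain ⟨h1, h2, h3⟩ := hU z hz
    have h4 : ContDiffAt ℝ ∞ (fun t : ℝ ↦ (√t)⁻¹) (S.g.fn W W z) :=
      (Real.contDiffAt_sqrt h1.ne').inv (Real.sqrt_ne_zero'.2 h1)
    exact (h4.contMDiffAt.comp z h2).smul_section h3
  · simp [hWη]
  · have h1 := (hU y hy).1
    have h2 : √(S.g.fn W W y) ≠ 0 := Real.sqrt_ne_zero'.2 h1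
    have h3 := Real.mul_self_sqrt h1.le
    change S.g.inner y ((√(S.g.fn W W y))⁻¹ • W y) ((√(S.g.fn W W y))⁻¹ • W y) = 1
    simp only [map_smul, smul_apply, smul_eq_mul]
    change _ * (_ * S.g.fn W W y) = 1
    field_simp
    rw [sq, h3]

variable {S x}

lemma smoothField_φField {X : ∀ x : M, TangentSpace 𝓘(ℝ, E) x} (hX : SmoothField X x) :
    SmoothField (S.φField X) x := by
  filter_upwards [hX] with y hy
  exact ContMDiffAt.clm_bundle_apply (F₁ := E) (F₂ := E) (S.contMDiff_φ y) hy

/-- The frame `(ξ, X, φ X)`. -/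
def frame (S : ParacontactMetricStructure E M) (X : ∀ x : M, TangentSpace 𝓘(ℝ, E) x) :
    Fin 3 → ∀ x : M, TangentSpace 𝓘(ℝ, E) x := ![S.ξ, X, S.φField X]

lemma isOrthonormalFrame (hE : Module.finrank ℝ E = 3) {U : Set M}
    {X : ∀ x : M, TangentSpace 𝓘(ℝ, E) x} (hU : IsOpen U)
    (hX : ∀ y ∈ U, SmoothField X y ∧ S.η y (X y) = 0 ∧ S.g.inner y (X y) (X y) = 1) :
    IsOrthonormalFrame S.g U (S.frame X) ![1, 1, -1] where
  isOpen := hU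
  card := by simp [hE]
  smooth i y hy := by
    fin_cases i
    · exact Eventually.of_forall S.contMDiff_ξ
    · exact (hX y hy).1
    · exact smoothField_φField (hX y hy).1
  inner_eq i j y hy := by
    obtain ⟨-, h1, h2⟩ := hX y hy
    have h3 : S.g.inner y (S.φ y (X y)) (X y) = 0 := by
      have := S.inner_φ_swap y (X y) (X y)
      rw [S.g.symm]
      linarith
    have h4 := S.η_φ y (X y)
    have h5 := S.inner_φ_φ y (X y) (X y)
    rw [S.η_eq] at h1 h4
    rw [S.η_eq, h1, h2] at h5
    fin_cases i <;> fin_cases j <;>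
      simp [frame, φField, h1, h2, h3, h4, h5, S.inner_ξ_ξ, S.g.symm y (S.ξ y),
        S.g.symm y (X y) (S.φ y (X y))]
  sign_sq i := by fin_cases i <;> simp

section Adapted

variable {U : Set M} {X : ∀ x : M, TangentSpace 𝓘(ℝ, E) x}

lemma η_frame (h : IsOrthonormalFrame S.g U (S.frame X) ![1, 1, -1])
    {y : M} (hy : y ∈ U) (i : Fin 3) :
    S.η y (S.frame X i y) = if i = 0 then 1 else 0 := by
  rw [S.η_eq, show S.ξ y = S.frame X 0 y from rfl, h.inner_eq _ _ y hy]
  fin_cases i <;> simp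

lemma φ_frame_two (h : IsOrthonormalFrame S.g U (S.frame X) ![1, 1, -1])
    {y : M} (hy : y ∈ U) : S.φ y (S.frame X 2 y) = X y := by
  have : S.η y (X y) = 0 := (η_frame h hy 1).trans (if_neg one_ne_zero)
  change S.φ y (S.φ y (X y)) = X y
  simp [S.φ_sq, this]

lemma extDeriv_frame (h : IsOrthonormalFrame S.g U (S.frame X) ![1, 1, -1])
    (u : U) (i j : Fin 3) :
    extDeriv S.η (S.frame X i) (S.frame X j) u = -(1 / 2) * (h.c i j 0).1 u := by
  have e (i j : Fin 3) : dirDeriv (S.frame X i) (fun y ↦ S.η y (S.frame X j y)) u = 0 := by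
    rw [dirDeriv_congr (f' := fun _ ↦ if j = 0 then 1 else 0), dirDeriv_const]
    filter_upwards [h.isOpen.mem_nhds u.2] with y hy using η_frame h hy j
  rw [extDeriv, e, e, S.η_eq]
  change _ = _ * S.g.inner u (mlieBracket 𝓘(ℝ, E) (S.frame X i) (S.frame X j) u) (S.ξ u)
  ring

/-- Since η is constant on each frame field, dη(F i, F j) reduces to -η([F i, F j])/2. -/
lemma c_zero (h : IsOrthonormalFrame S.g U (S.frame X) ![1, 1, -1])
    (u : U) (i j : Fin 3) :
    (h.c i j 0).1 u = -2 * S.g.inner u (S.frame X i u) (S.φ u (S.frame X j u)) := by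
  have := extDeriv_frame h u i j
  rw [S.extDeriv_eq _ _ _ (h.smooth i u u.2).diffAt (h.smooth j u u.2).diffAt] at this
  linarith

/-- The entries with last index 0 come from dη = g(·, φ·); μ and τ are the half-sum and
half-difference of the two off-diagonal entries of ad ξ. -/
lemma isAdapted (h : IsOrthonormalFrame S.g U (S.frame X) ![1, 1, -1]) :
    h.IsAdapted (h.c 0 1 1) ((1 / 2 : ℝ) • (h.c 0 2 1 + h.c 0 1 2))
    ((1 / 2 : ℝ) • (h.c 0 2 1 - h.c 0 1 2)) (h.c 1 2 1) (-h.c 1 2 2) := by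
  have two (a : smoothAlgebra E U) : 2 * ((1 / 2 : ℝ) • a) = a := by
    rw [two_mul, ← two_smul ℝ, smul_smul]
    norm_num
  have c0 (i : Fin 3) : h.c 0 i 0 = 0 := smoothAlgebra_ext fun u ↦ by
    have e := c_zero h u 0 i
    rw [S.inner_φ_swap] at e
    rw [e]
    change -2 * -S.g.inner u (S.frame X i u) (S.φ u (S.ξ u)) = 0
    simp [S.φ_ξ]
  have c12 : h.c 1 2 0 = -2 := smoothAlgebra_ext fun u ↦ by
    rw [c_zero h u 1 2, φ_frame_two h u.2]
    change -2 * S.g.inner u (S.frame X 1 u) (S.frame X 1 u) = -2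
    rw [h.inner_eq 1 1 u u.2]
    simp
  refine ⟨c0 1, rfl, ?_, c0 2, ?_, ?_, c12, rfl, (neg_neg _).symm⟩
  · apply eq_of_two_mul_eq
    linear_combination two (h.c 0 2 1 - h.c 0 1 2) - two (h.c 0 2 1 + h.c 0 1 2)
  · apply eq_of_two_mul_eq
    linear_combination -two (h.c 0 2 1 - h.c 0 1 2) - two (h.c 0 2 1 + h.c 0 1 2)
  · have := h.c_jacobi 0 1 2 0
    simp [Fin.sum_univ_three, h.c_self, h.c_swap 0 1, h.c_swap 0 2, h.c_swap 1 2, c0, c12] at this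
    apply eq_of_two_mul_eq
    have e : h.D 0 2 = 0 := by exact_mod_cast (h.D 0).map_natCast 2
    linear_combination -this - e

end Adapted

end ParacontactMetricStructure

end

section

/-! ### Functions with vanishing differential -/

section Constant

variable {E : Type*} [NormedAddCommGroup E] [NormedSpace ℝ E]
  {M : Type*} [TopologicalSpace M] [ChartedSpace E M] [IsManifold 𝓘(ℝ, E) ∞ M]

/-- In a chart, restrict to a ball inside the target; a function with zero derivative on a convex
set is constant. -/
lemma isLocallyConstant_of_mfderiv_eq_zero {f : M → ℝ}
    (hf : ∀ x, MDifferentiableAt 𝓘(ℝ, E) 𝓘(ℝ, ℝ) f x)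
    (h : ∀ x, mfderiv 𝓘(ℝ, E) 𝓘(ℝ, ℝ) f x = 0) : IsLocallyConstant f := by
  have : IsManifold 𝓘(ℝ, E) 1 M := .of_le (n := ∞) (by simp)
  rw [IsLocallyConstant.iff_eventually_eq]
  intro x
  obtain ⟨r, hr, hB⟩ := Metric.isOpen_iff.1 (isOpen_extChartAt_target (I := 𝓘(ℝ, E)) x)
    (extChartAt 𝓘(ℝ, E) x x) (mem_extChartAt_target x)
  set F : E → ℝ := f ∘ (extChartAt 𝓘(ℝ, E) x).symm
  have hd (z : E) (hz : z ∈ Metric.ball (extChartAt 𝓘(ℝ, E) x x) r) : HasFDerivAt F (0 : E →L[ℝ] ℝ) z := by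
    have h1 : MDifferentiableAt 𝓘(ℝ, E) 𝓘(ℝ, E) (extChartAt 𝓘(ℝ, E) x).symm z := by
      have := mdifferentiableOn_extChartAt_symm (I := 𝓘(ℝ, E)) (x := x) z (hB hz)
      exact this.mdifferentiableAt ((isOpen_extChartAt_target x).mem_nhds (hB hz))
    have h2 := HasMFDerivAt.comp z (hf _).hasMFDerivAt h1.hasMFDerivAt
    rw [h, ContinuousLinearMap.zero_comp] at h2
    exact hasMFDerivAt_iff_hasFDerivAt.1 h2
  have hconst (z : E) (hz : z ∈ Metric.ball (extChartAt 𝓘(ℝ, E) x x) r) :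
      F z = F (extChartAt 𝓘(ℝ, E) x x) :=
    (convex_ball _ _).is_const_of_fderivWithin_eq_zero (𝕜 := ℝ)
      (fun y hy ↦ (hd y hy).differentiableAt.differentiableWithinAt)
      (fun y hy ↦ (hd y hy).hasFDerivWithinAt.fderivWithin
        (Metric.isOpen_ball.uniqueDiffWithinAt hy)) hz (Metric.mem_ball_self hr)
  filter_upwards [(continuousAt_extChartAt (I := 𝓘(ℝ, E)) x).preimage_mem_nhds
    (Metric.ball_mem_nhds _ hr), extChartAt_source_mem_nhds (I := 𝓘(ℝ, E)) x] with y hy hy'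
  have := hconst _ hy
  change f ((extChartAt 𝓘(ℝ, E) x).symm _) = f ((extChartAt 𝓘(ℝ, E) x).symm _) at this
  rwa [(extChartAt 𝓘(ℝ, E) x).left_inv hy', extChartAt_to_inv] at this

end Constant

variable {E : Type*} [NormedAddCommGroup E] [NormedSpace ℝ E] [FiniteDimensional ℝ E]
  {M : Type*} [TopologicalSpace M] [ChartedSpace E M] [IsManifold 𝓘(ℝ, E) ∞ M]

/-! ### Ricci tensor, l and h in a frame -/

namespace PseudoRiemannianMetric

lemma inner_ricciOperator (g : PseudoRiemannianMetric E M) (x : M)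
    (v w : TangentSpace 𝓘(ℝ, E) x) : g.inner x (g.ricciOperator x v) w = g.ricci x v w :=
  g.inner_flat_symm x _ _

end PseudoRiemannianMetric

namespace IsOrthonormalFrame

variable {g : PseudoRiemannianMetric E M} {ι : Type*} [Fintype ι] [DecidableEq ι] {U : Set M}
  {F : ι → ∀ x : M, TangentSpace 𝓘(ℝ, E) x} {ε : ι → ℝ}

lemma ricci_eq [Nontrivial E] (h : IsOrthonormalFrame g U F ε) (u : U) (j k : ι) :
    g.ricci u (F j u) (F k u) = ∑ i, ε i * (h.R i j k i).1 u := by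
  rw [ricci, LinearMap.mk₂_apply, h.trace_eq u.2]
  simp only [LinearMap.flip_apply, h.inner_curvature]

lemma scal_eq [Nontrivial E] (h : IsOrthonormalFrame g U F ε) (u : U) :
    g.scal u = ∑ j, ε j * ∑ i, ε i * (h.R i j j i).1 u := by
  rw [scal, h.trace_eq u.2]
  simp only [g.inner_ricciOperator, h.ricci_eq]

/-- A function on `U` whose derivatives along a frame vanish has vanishing differential. -/
lemma mfderiv_eq_zero (h : IsOrthonormalFrame g U F ε) {f : M → ℝ} {a : smoothAlgebra E U}
    (hf : ∀ u : U, f u = a.1 u) (ha : ∀ i, h.D i a = 0) (u : U) :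
    MDifferentiableAt 𝓘(ℝ, E) 𝓘(ℝ, ℝ) f u ∧ mfderiv 𝓘(ℝ, E) 𝓘(ℝ, ℝ) f u = 0 := by
  obtain ⟨f', hf', rfl⟩ := exists_eq_restrict a
  have e : f =ᶠ[𝓝 (u : M)] f' := by
    filter_upwards [h.isOpen.mem_nhds u.2] with y hy using hf ⟨y, hy⟩
  refine ⟨(hf' u u.2).mdifferentiableAt.congr_of_eventuallyEq e, ?_⟩
  have h1 (i : ι) : mfderiv 𝓘(ℝ, E) 𝓘(ℝ, ℝ) f u (F i u) = 0 := by
    have h2 := congrFun (congrArg Subtype.val (ha i)) u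
    rwa [D, derivation_val h.isOpen (h.smooth i) hf] at h2
  refine ContinuousLinearMap.ext fun v ↦ ?_
  rw [h.eq_sum u.2 v, map_sum]
  exact Finset.sum_eq_zero fun i _ ↦ by rw [map_smul, h1]; exact smul_zero _

end IsOrthonormalFrame

namespace ParacontactMetricStructure

variable {S : ParacontactMetricStructure E M} {U : Set M} {X : ∀ x : M, TangentSpace 𝓘(ℝ, E) x}

section

variable {p μ τ α β : smoothAlgebra E U}

/-- The trace is R0202 - R0101, in which the ∇'_ξ h terms cancel; no condition on Q is involved. -/
lemma trace_l [Nontrivial E] (h : IsOrthonormalFrame S.g U (S.frame X) ![1, 1, -1])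
    (H : h.IsAdapted p μ τ α β) (u : U) :
    LinearMap.trace ℝ (TangentSpace 𝓘(ℝ, E) (u : M)) (S.l u)
      = (2 * (μ * μ - p * p - 1) : smoothAlgebra E U).1 u := by
  obtain ⟨e1, e2, -⟩ := H.R_eq
  have e3 : h.R 1 0 0 1 - h.R 2 0 0 2 = 2 * (μ * μ - p * p - 1) := by
    rw [h.R_swap_left 0 1, h.R_swap_left 0 2, e1, e2]
    ring
  rw [h.trace_eq u.2, ← e3]
  have e4 (i : Fin 3) : S.g.inner u (S.l u (S.frame X i u)) (S.frame X i u)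
      = (h.R i 0 0 i).1 u := (h.inner_curvature u i 0 0 i)
  simp only [e4, Fin.sum_univ_three, h.R_self_left]
  simp
  ring

lemma h_apply {x : M} (hX : DiffAt X x) : S.h x (X x) = S.hField X x :=
  TensorialAt.mkHom_apply (I := 𝓘(ℝ, E)) (F := E) _ hX

/-- In [ξ, φe] - φ[ξ, e] the function τ cancels, so that h sees only μ and p. -/
lemma h_frame (h : IsOrthonormalFrame S.g U (S.frame X) ![1, 1, -1])
    (H : h.IsAdapted p μ τ α β) (u : U) :
    S.h u (S.frame X 0 u) = 0 ∧
    S.h u (S.frame X 1 u) = μ.1 u • S.frame X 1 u - p.1 u • S.frame X 2 u ∧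
    S.h u (S.frame X 2 u) = p.1 u • S.frame X 1 u - μ.1 u • S.frame X 2 u := by
  have hc (i j k : Fin 3) : S.g.inner u (mlieBracket 𝓘(ℝ, E) (S.frame X i) (S.frame X j) u)
      (S.frame X k u) = (h.c i j k).1 u := rfl
  have hF (i : Fin 3) := (h.smooth i u u.2).diffAt
  have hφ0 : S.φ u (S.frame X 0 u) = 0 := S.φ_ξ u
  have hφ1 : S.φ u (S.frame X 1 u) = S.frame X 2 u := rfl
  have hφ2 : S.φ u (S.frame X 2 u) = S.frame X 1 u := φ_frame_two h u.2
  have e0 : S.φField (S.frame X 0) = 0 := funext fun y ↦ S.φ_ξ y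
  have e2 : S.φField (S.frame X 2) =ᶠ[𝓝 (u : M)] S.frame X 1 := by
    filter_upwards [h.isOpen.mem_nhds u.2] with y hy using φ_frame_two h hy
  have hi (v w : TangentSpace 𝓘(ℝ, E) (u : M)) :
      S.g.inner u (S.φ u v) w = -S.g.inner u v (S.φ u w) := by
    rw [S.g.symm, S.inner_φ_swap]
  have c010 : (h.c 0 1 0).1 u = 0 := congrFun (congrArg Subtype.val H.c010) u
  have c011 : (h.c 0 1 1).1 u = p.1 u := congrFun (congrArg Subtype.val H.c011) u
  have c012 : (h.c 0 1 2).1 u = -(τ.1 u - μ.1 u) := congrFun (congrArg Subtype.val H.c012) u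
  have c020 : (h.c 0 2 0).1 u = 0 := congrFun (congrArg Subtype.val H.c020) u
  have c021 : (h.c 0 2 1).1 u = τ.1 u + μ.1 u := congrFun (congrArg Subtype.val H.c021) u
  have c022 : (h.c 0 2 2).1 u = p.1 u := congrFun (congrArg Subtype.val H.c022) u
  refine ⟨?_, ?_, ?_⟩
  · rw [h_apply (hF 0), hField, e0]
    change (1 / 2 : ℝ) • (_ - S.φ u (mlieBracket 𝓘(ℝ, E) (S.frame X 0) (S.frame X 0) u)) = 0
    simp
  · refine h.ext_inner u.2 fun i ↦ ?_
    rw [h_apply (hF 1), hField]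
    change S.g.inner u ((1 / 2 : ℝ) • (mlieBracket 𝓘(ℝ, E) (S.frame X 0) (S.frame X 2) u
      - S.φ u (mlieBracket 𝓘(ℝ, E) (S.frame X 0) (S.frame X 1) u))) _ = _
    simp only [map_smul, map_sub, smul_apply, sub_apply, smul_eq_mul, hi, hc]
    match i with
    | 0 => simp [hφ0, c020, h.inner_eq _ _ u u.2]
    | 1 =>
      rw [hφ1, hc, c021, c012, h.inner_eq _ _ u u.2, h.inner_eq _ _ u u.2]
      simp
      ring
    | 2 =>
      rw [hφ2, hc, c022, c011, h.inner_eq _ _ u u.2, h.inner_eq _ _ u u.2]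
      simp
      ring
  · refine h.ext_inner u.2 fun i ↦ ?_
    rw [h_apply (hF 2), hField,
      (EventuallyEq.refl _ S.ξ).mlieBracket_vectorField_eq (I := 𝓘(ℝ, E)) e2]
    change S.g.inner u ((1 / 2 : ℝ) • (mlieBracket 𝓘(ℝ, E) (S.frame X 0) (S.frame X 1) u
      - S.φ u (mlieBracket 𝓘(ℝ, E) (S.frame X 0) (S.frame X 2) u))) _ = _
    simp only [map_smul, map_sub, smul_apply, sub_apply, smul_eq_mul, hi, hc]
    match i with
    | 0 => simp [hφ0, c010, h.inner_eq _ _ u u.2]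
    | 1 =>
      rw [hφ1, hc, c011, c022, h.inner_eq _ _ u u.2, h.inner_eq _ _ u u.2]
      simp
      ring
    | 2 =>
      rw [hφ2, hc, c012, c021, h.inner_eq _ _ u u.2, h.inner_eq _ _ u u.2]
      simp
      ring

/-- On ker η, h² is multiplication by μ² - p². -/
lemma trace_h_sq (h : IsOrthonormalFrame S.g U (S.frame X) ![1, 1, -1])
    (H : h.IsAdapted p μ τ α β) (u : U) :
    LinearMap.trace ℝ (TangentSpace 𝓘(ℝ, E) (u : M)) (S.h u ∘ₗ S.h u)
      = (2 * (μ * μ - p * p) : smoothAlgebra E U).1 u := by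
  obtain ⟨e0, e1, e2⟩ := h_frame h H u
  rw [h.trace_eq u.2]
  simp only [Fin.sum_univ_three, LinearMap.comp_apply, e0, e1, e2, map_sub, map_smul, map_zero,
    sub_apply, smul_apply, smul_eq_mul, zero_apply, h.inner_eq _ _ u u.2]
  simp
  change _ = 2 * (μ.1 u * μ.1 u - p.1 u * p.1 u)
  ring

/-- The curvature conditions expressed by `Q φ = φ Q`. -/
lemma R_of_ricciOperator_comm [Nontrivial E]
    (hQ : ∀ (x : M) (v : TangentSpace 𝓘(ℝ, E) x),
      S.g.ricciOperator x (S.φ x v) = S.φ x (S.g.ricciOperator x v))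
    (h : IsOrthonormalFrame S.g U (S.frame X) ![1, 1, -1]) :
    h.R 1 2 0 1 = 0 ∧ h.R 1 2 0 2 = 0 ∧ h.R 0 1 0 2 + h.R 0 2 0 1 = 0 ∧
      h.R 0 1 0 1 + h.R 0 2 0 2 = 0 := by
  -- As φ is skew, commuting with Q means Ric(φv, w) = -Ric(v, φw). The four conclusions are this
  -- identity at (e, ξ), (φe, ξ), (e, e) and (e, φe).
  have key (u : U) (v w : TangentSpace 𝓘(ℝ, E) (u : M)) :
      S.g.ricci u (S.φ u v) w = -S.g.ricci u v (S.φ u w) := by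
    rw [← S.g.inner_ricciOperator, ← S.g.inner_ricciOperator, hQ, S.g.symm, S.inner_φ_swap]
  have hφ0 (u : U) : S.φ u (S.frame X 0 u) = 0 := S.φ_ξ u
  have hφ1 (u : U) : S.φ u (S.frame X 1 u) = S.frame X 2 u := rfl
  have hφ2 (u : U) : S.φ u (S.frame X 2 u) = S.frame X 1 u := φ_frame_two h u.2
  refine ⟨smoothAlgebra_ext fun u ↦ ?_, smoothAlgebra_ext fun u ↦ ?_, smoothAlgebra_ext fun u ↦ ?_,
    smoothAlgebra_ext fun u ↦ ?_⟩
  · have e := key u (S.frame X 1 u) (S.frame X 0 u)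
    rw [hφ1, hφ0, map_zero, neg_zero, h.ricci_eq] at e
    simpa [Fin.sum_univ_three, h.R_self_left, h.R_self_right] using e
  · have e := key u (S.frame X 2 u) (S.frame X 0 u)
    rw [hφ2, hφ0, map_zero, neg_zero, h.ricci_eq] at e
    simpa [Fin.sum_univ_three, h.R_self_left, h.R_self_right, h.R_swap_left 1 2] using e
  · have e := key u (S.frame X 1 u) (S.frame X 1 u)
    rw [hφ1, h.ricci_eq, h.ricci_eq] at e
    simp [Fin.sum_univ_three, h.R_self_left, h.R_self_right, h.R_swap_right 0 1 0 2,
      h.R_swap_right 0 2 0 1] at e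
    change (h.R 0 1 0 2).1 u + (h.R 0 2 0 1).1 u = 0
    linarith
  · have e := key u (S.frame X 1 u) (S.frame X 2 u)
    rw [hφ1, hφ2, h.ricci_eq, h.ricci_eq] at e
    simp [Fin.sum_univ_three, h.R_self_left, h.R_swap_right 0 1 0 1, h.R_swap_right 0 2 0 2,
      h.R_swap_right 1 2 1 2, h.R_swap_left 1 2] at e
    change (h.R 0 1 0 1).1 u + (h.R 0 2 0 2).1 u = 0
    linarith

end

end ParacontactMetricStructure

end

/-! ### Constancy of tr l and the curvature when k ≠ -1 -/

section

variable {E : Type*} [NormedAddCommGroup E] [NormedSpace ℝ E] [FiniteDimensional ℝ E]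
  {M : Type*} [TopologicalSpace M] [ChartedSpace E M] [IsManifold 𝓘(ℝ, E) ∞ M]

namespace IsOrthonormalFrame

variable {g : PseudoRiemannianMetric E M} {U : Set M}
  {F : Fin 3 → ∀ x : M, TangentSpace 𝓘(ℝ, E) x}

/-- The components of the curvature tensor at `u` in a frame `(ξ, e, φ e)` with `ξ`-sectional
curvature `k` and `φ`-sectional curvature `-k`. -/
structure HasConstR (h : IsOrthonormalFrame g U F ![1, 1, -1]) (u : U) (k : ℝ) : Prop where
  R0101 : (h.R 0 1 0 1).1 u = -k
  R0202 : (h.R 0 2 0 2).1 u = k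
  R0102 : (h.R 0 1 0 2).1 u = 0
  R0201 : (h.R 0 2 0 1).1 u = 0
  R1201 : (h.R 1 2 0 1).1 u = 0
  R1202 : (h.R 1 2 0 2).1 u = 0
  R0112 : (h.R 0 1 1 2).1 u = 0
  R0212 : (h.R 0 2 1 2).1 u = 0
  R1212 : (h.R 1 2 1 2).1 u = -k

variable {h : IsOrthonormalFrame g U F ![1, 1, -1]} {u : U} {k : ℝ}

lemma HasConstR.curvature_frame [Nontrivial E] (H : h.HasConstR u k) :
    g.curvature u (F 0 u) (F 1 u) (F 0 u) = -k • F 1 u ∧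
    g.curvature u (F 0 u) (F 1 u) (F 1 u) = k • F 0 u ∧
    g.curvature u (F 0 u) (F 1 u) (F 2 u) = 0 ∧
    g.curvature u (F 0 u) (F 2 u) (F 0 u) = -k • F 2 u ∧
    g.curvature u (F 0 u) (F 2 u) (F 1 u) = 0 ∧
    g.curvature u (F 0 u) (F 2 u) (F 2 u) = -k • F 0 u ∧
    g.curvature u (F 1 u) (F 2 u) (F 0 u) = 0 ∧
    g.curvature u (F 1 u) (F 2 u) (F 1 u) = k • F 2 u ∧
    g.curvature u (F 1 u) (F 2 u) (F 2 u) = k • F 1 u := by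
  have neg (a : smoothAlgebra E U) : (-a).1 u = -a.1 u := rfl
  have zero : (0 : smoothAlgebra E U).1 u = 0 := rfl
  refine ⟨?_, ?_, ?_, ?_, ?_, ?_, ?_, ?_, ?_⟩ <;> refine h.ext_inner u.2 fun l ↦ ?_ <;>
    rw [h.inner_curvature] <;>
    match l with
    | 0 | 1 | 2 =>
      simp only [h.R_self_right, h.R_swap_right _ _ 0 1, h.R_swap_right _ _ 0 2,
        h.R_swap_right _ _ 1 2, neg, zero, H.R0101, H.R0202, H.R0102, H.R0201, H.R1201, H.R1202,
        H.R0112, H.R0212, H.R1212, map_smul, map_zero, smul_apply, zero_apply,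
        h.inner_eq _ _ u u.2] <;> simp

lemma curvature_swap [Nontrivial E] (h : IsOrthonormalFrame g U F ![1, 1, -1]) (u : U)
    (v w z : TangentSpace 𝓘(ℝ, E) (u : M)) : g.curvature u v w z = -g.curvature u w v z := by
  have e : g.curvature u = -(g.curvature u).flip := by
    refine (h.basis u.2).ext fun i ↦ (h.basis u.2).ext fun j ↦ (h.basis u.2).ext fun k ↦ ?_
    refine h.ext_inner u.2 fun l ↦ ?_
    simp only [basis_apply, LinearMap.neg_apply, LinearMap.flip_apply, map_neg, neg_apply,
      h.inner_curvature, h.R_swap_left i j]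
    exact (neg_neg _).symm
  conv_lhs => rw [e]
  rfl

lemma HasConstR.curvature_eq_zero [Nontrivial E] (H : h.HasConstR u 0)
    (v w z : TangentSpace 𝓘(ℝ, E) (u : M)) : g.curvature u v w z = 0 := by
  obtain ⟨e1, e2, e3, e4, e5, e6, e7, e8, e9⟩ := H.curvature_frame
  have self (v z : TangentSpace 𝓘(ℝ, E) (u : M)) : g.curvature u v v z = 0 := by
    have := curvature_swap h u v v z
    rwa [eq_neg_iff_add_eq_zero, ← two_smul ℝ, smul_eq_zero_iff_right two_ne_zero] at this
  have e : g.curvature u = 0 := by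
    refine (h.basis u.2).ext fun i ↦ (h.basis u.2).ext fun j ↦ (h.basis u.2).ext fun k ↦ ?_
    simp only [basis_apply, LinearMap.zero_apply]
    match i, j, k with
    | 0, 0, _ | 1, 1, _ | 2, 2, _ => exact self _ _
    | 0, 1, 0 | 0, 1, 1 | 0, 1, 2 | 0, 2, 0 | 0, 2, 1 | 0, 2, 2 | 1, 2, 0 | 1, 2, 1 | 1, 2, 2 =>
      simp [e1, e2, e3, e4, e5, e6, e7, e8, e9]
    | 1, 0, 0 | 1, 0, 1 | 1, 0, 2 | 2, 0, 0 | 2, 0, 1 | 2, 0, 2 | 2, 1, 0 | 2, 1, 1 | 2, 1, 2 =>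
      rw [curvature_swap h]
      simp [e1, e2, e3, e4, e5, e6, e7, e8, e9]
  rw [e]
  rfl

lemma HasConstR.scal_eq [Nontrivial E] (H : h.HasConstR u k) : g.scal u = 2 * k := by
  have neg (a : smoothAlgebra E U) : (-a).1 u = -a.1 u := rfl
  have zero : (0 : smoothAlgebra E U).1 u = 0 := rfl
  rw [h.scal_eq]
  simp only [Fin.sum_univ_three, h.R_self_left, h.R_swap_left 0 1, h.R_swap_left 0 2,
    h.R_swap_left 1 2, h.R_swap_right _ _ 0 1, h.R_swap_right _ _ 0 2, h.R_swap_right _ _ 1 2,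
    neg, zero, H.R0101, H.R0202, H.R1212]
  simp
  ring

end IsOrthonormalFrame

namespace ParacontactMetricStructure

variable {S : ParacontactMetricStructure E M} {U : Set M} {X : ∀ x : M, TangentSpace 𝓘(ℝ, E) x}
  {p μ τ α β : smoothAlgebra E U}

/-- The first two equations say ∇'_ξ h = 0; the last two are the Codazzi equations contained in
Ric(ξ, e) = Ric(ξ, φe) = 0. -/
lemma structure_equations [Nontrivial E]
    (hQ : ∀ (x : M) (v : TangentSpace 𝓘(ℝ, E) x),
      S.g.ricciOperator x (S.φ x v) = S.φ x (S.g.ricciOperator x v))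
    (h : IsOrthonormalFrame S.g U (S.frame X) ![1, 1, -1]) (H : h.IsAdapted p μ τ α β) :
    h.D 0 p = -2 * ((1 - τ) * μ) ∧ h.D 0 μ = -2 * ((1 - τ) * p) ∧
      h.D 2 p = h.D 1 μ - 2 * (α * p) - 2 * (β * μ) ∧
      h.D 2 μ = h.D 1 p - 2 * (α * μ) - 2 * (β * p) := by
  obtain ⟨e1, e2, e3, e4, e5, e6, -⟩ := H.R_eq
  obtain ⟨f1, f2, f3, f4⟩ := R_of_ricciOperator_comm hQ h
  rw [e1, e2] at f4
  rw [e3, e4] at f3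
  rw [e5] at f1
  rw [e6] at f2
  refine ⟨?_, ?_, ?_, ?_⟩ <;> apply eq_of_two_mul_eq
  · linear_combination -f4
  · linear_combination -f3
  · linear_combination 2 * f1
  · linear_combination 2 * f2

lemma D_trace_l [Nontrivial E]
    (hQ : ∀ (x : M) (v : TangentSpace 𝓘(ℝ, E) x),
      S.g.ricciOperator x (S.φ x v) = S.φ x (S.g.ricciOperator x v))
    (h : IsOrthonormalFrame S.g U (S.frame X) ![1, 1, -1]) (H : h.IsAdapted p μ τ α β)
    (i : Fin 3) : h.D i (2 * (μ * μ - p * p - 1)) = 0 := by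
  obtain ⟨e1, e2, e3, e4⟩ := structure_equations hQ h H
  obtain ⟨d0, d1, d2⟩ := derivation_det_eq_zero H.comm₀₁ H.comm₀₂ H.jacobi₁ H.jacobi₂ e1 e2 e3 e4
  rw [two_mul, map_add, map_sub (h.D i) (μ * μ - p * p), Derivation.map_one_eq_zero]
  match i with
  | 0 => rw [d0]; simp
  | 1 => rw [d1]; simp
  | 2 => rw [d2]; simp

/-- For k ≠ -1 the function μ² - p² = k + 1 is a unit, so dθ(e, φe) = 0 and the Gauss equation
leaves R1212 = -k. The structure equations settle the other components. -/
lemma hasConstR [Nontrivial E]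
    (hQ : ∀ (x : M) (v : TangentSpace 𝓘(ℝ, E) x),
      S.g.ricciOperator x (S.φ x v) = S.φ x (S.g.ricciOperator x v))
    (h : IsOrthonormalFrame S.g U (S.frame X) ![1, 1, -1]) (H : h.IsAdapted p μ τ α β) {k : ℝ}
    (hk : ∀ u : U, (2 * (μ * μ - p * p - 1) : smoothAlgebra E U).1 u = 2 * k) (hk' : k ≠ -1)
    (u : U) : h.HasConstR u k := by
  obtain ⟨e1, e2, e3, e4⟩ := structure_equations hQ h H
  obtain ⟨r1, r2, r3, r4, r5, r6, r7, r8, r9⟩ := H.R_eq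
  have hd : μ * μ - p * p - 1 = algebraMap ℝ _ k :=
    eq_of_two_mul_eq (smoothAlgebra_ext fun u ↦ hk u)
  have hu : IsUnit (μ * μ - p * p) := by
    have e : μ * μ - p * p = algebraMap ℝ _ (k + 1) := by
      rw [map_add, map_one, ← hd]
      ring
    rw [e]
    exact (IsUnit.mk0 (k + 1) fun h ↦ hk' (by linarith)).map _
  have hω := curvature_form_eq_zero H.comm₀₁ H.comm₀₂ H.comm₁₂ H.jacobi₁ H.jacobi₂ e1 e2 e3 e4 hu
  have g1 : h.R 1 2 0 1 = 0 := by rw [r5, e3]; ring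
  have g2 : h.R 1 2 0 2 = 0 := by rw [r6, e4]; ring
  rw [hd, e1] at r1 r2
  rw [e2] at r3 r4
  rw [hd, hω] at r9
  rw [g1] at r7
  rw [g2] at r8
  constructor
  · rw [r1]; change -(-2 * _ + 2 * _) - k = -k; ring
  · rw [r2]; change -(-2 * _ + 2 * _) + k = k; ring
  · rw [r3]; change -(-2 * _ + 2 * _) = (0 : ℝ); ring
  · rw [r4]; change -(-2 * _ + 2 * _) = (0 : ℝ); ring
  · rw [g1]; rfl
  · rw [g2]; rfl
  · rw [r7]; rfl
  · rw [r8]; rfl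
  · rw [r9]; change 0 - k = -k; ring

/-- Vectors orthogonal to `ξ` in an adapted frame. -/
lemma exists_eq_frame (h : IsOrthonormalFrame S.g U (S.frame X) ![1, 1, -1]) (u : U)
    {v : TangentSpace 𝓘(ℝ, E) (u : M)} (hv : S.g.inner u v (S.ξ u) = 0) :
    ∃ a b : ℝ, v = a • S.frame X 1 u + b • S.frame X 2 u ∧
      S.φ u v = b • S.frame X 1 u + a • S.frame X 2 u ∧ S.g.inner u v v = a ^ 2 - b ^ 2 := by
  have e := h.eq_sum u.2 v
  have e0 : S.g.inner u v (S.frame X 0 u) = 0 := hv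
  rw [Fin.sum_univ_three, e0, mul_zero, zero_smul, zero_add] at e
  generalize (![1, 1, -1] : Fin 3 → ℝ) 1 * S.g.inner u v (S.frame X 1 u) = a at e
  generalize (![1, 1, -1] : Fin 3 → ℝ) 2 * S.g.inner u v (S.frame X 2 u) = b at e
  refine ⟨a, b, e, ?_, ?_⟩
  · rw [e, map_add, map_smul, map_smul, φ_frame_two h u.2, add_comm]
    rfl
  · rw [e]
    simp only [map_add, map_smul, add_apply, smul_apply, smul_eq_mul, h.inner_eq _ _ u u.2]
    simp
    ring

lemma sectionalCurvature_ξ [Nontrivial E] {h : IsOrthonormalFrame S.g U (S.frame X) ![1, 1, -1]}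
    {u : U} {k : ℝ} (H : h.HasConstR u k) {v : TangentSpace 𝓘(ℝ, E) (u : M)}
    (hv : S.g.inner u v (S.ξ u) = 0) (hv' : S.g.inner u v v ≠ 0) :
    S.g.sectionalCurvature u (S.ξ u) v = k := by
  obtain ⟨e1, e2, e3, e4, e5, e6, e7, e8, e9⟩ := H.curvature_frame
  obtain ⟨a, b, ev, -, evv⟩ := exists_eq_frame h u hv
  have e0 : S.g.inner u (S.ξ u) v = 0 := by rw [S.g.symm, hv]
  have key : S.g.curvature u (S.ξ u) v v = (k * (a ^ 2 - b ^ 2)) • S.ξ u := by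
    change S.g.curvature u (S.frame X 0 u) v v = _ • S.frame X 0 u
    rw [ev]
    simp only [map_add, map_smul, LinearMap.add_apply, LinearMap.smul_apply, e2, e3, e5, e6]
    module
  rw [evv] at hv'
  rw [sectionalCurvature, key, map_smul, smul_apply, S.inner_ξ_ξ, e0, evv, smul_eq_mul,
    one_mul, mul_one, zero_pow two_ne_zero, sub_zero, mul_div_assoc, div_self hv', mul_one]

lemma sectionalCurvature_φ [Nontrivial E] {h : IsOrthonormalFrame S.g U (S.frame X) ![1, 1, -1]}
    {u : U} {k : ℝ} (H : h.HasConstR u k) {v : TangentSpace 𝓘(ℝ, E) (u : M)}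
    (hv : S.g.inner u v (S.ξ u) = 0) (hv' : S.g.inner u v v ≠ 0) :
    S.g.sectionalCurvature u v (S.φ u v) = -k := by
  obtain ⟨e1, e2, e3, e4, e5, e6, e7, e8, e9⟩ := H.curvature_frame
  obtain ⟨a, b, ev, eφ, evv⟩ := exists_eq_frame h u hv
  have self (v z : TangentSpace 𝓘(ℝ, E) (u : M)) : S.g.curvature u v v z = 0 := by
    have := h.curvature_swap u v v z
    rwa [eq_neg_iff_add_eq_zero, ← two_smul ℝ, smul_eq_zero_iff_right two_ne_zero] at this
  have e0 : S.g.inner u v (S.φ u v) = 0 := by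
    have := S.inner_φ_swap u v v
    linarith
  have eφφ : S.g.inner u (S.φ u v) (S.φ u v) = -(a ^ 2 - b ^ 2) := by
    rw [S.inner_φ_φ, S.η_eq, hv, evv]
    ring
  -- For v = a e + b φe one has φv = b e + a φe, so R(v, φv) = (a² - b²) R(e, φe), and R(e, φe)
  -- sends φv to k v.
  have key : S.g.curvature u v (S.φ u v) (S.φ u v) = (k * (a ^ 2 - b ^ 2)) • v := by
    rw [eφ, ev]
    simp only [map_add, map_smul, LinearMap.add_apply, LinearMap.smul_apply, self,
      h.curvature_swap u (S.frame X 2 u) (S.frame X 1 u), e8, e9]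
    module
  rw [evv] at hv'
  rw [sectionalCurvature, key, map_smul, smul_apply, e0, eφφ, evv, smul_eq_mul]
  field_simp
  ring

end ParacontactMetricStructure

end

end Paracontact

end

/-! ### From local frames to the trichotomy -/

open Paracontact ParacontactMetricStructure in
theorem mainTheorem1 {E : Type*} [NormedAddCommGroup E] [NormedSpace ℝ E] [FiniteDimensional ℝ E]
    (hE : Module.finrank ℝ E = 3)
    {M : Type*} [TopologicalSpace M] [T2Space M] [SecondCountableTopology M] [ConnectedSpace M]
    [ChartedSpace E M] [IsManifold 𝓘(ℝ, E) ∞ M]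
    (S : Paracontact.ParacontactMetricStructure E M)
    (hQ : ∀ (x : M) (v : TangentSpace 𝓘(ℝ, E) x),
      S.g.ricciOperator x (S.φ x v) = S.φ x (S.g.ricciOperator x v)) :
    ∃ k : ℝ,
      (∀ x : M, LinearMap.trace ℝ (TangentSpace 𝓘(ℝ, E) x) (S.l x) = 2 * k) ∧
      ((k = -1 ∧ ∀ x : M, LinearMap.trace ℝ (TangentSpace 𝓘(ℝ, E) x) (S.h x ∘ₗ S.h x) = 0) ∨
       (k = 0 ∧ S.g.IsFlat) ∨
       (k ≠ -1 ∧ k ≠ 0 ∧ -k ≠ 1 ∧ S.HasConstXiSectionalCurvature k ∧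
        S.HasConstPhiSectionalCurvature (-k) ∧ ∀ x : M, S.g.scal x = 2 * k)) := by
  have : Nontrivial E := Module.nontrivial_of_finrank_pos (R := ℝ) (by omega)
  have hframe (x : M) : ∃ (U : Set M) (X : ∀ x : M, TangentSpace 𝓘(ℝ, E) x) (_ : x ∈ U)
      (h : IsOrthonormalFrame S.g U (S.frame X) ![1, 1, -1])
      (p μ τ α β : smoothAlgebra E U), h.IsAdapted p μ τ α β := by
    obtain ⟨U, X, hU, hx, hX⟩ := S.exists_unit_field x hE
    exact ⟨U, X, hx, isOrthonormalFrame hE hU hX, _, _, _, _, _, isAdapted _⟩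
  set f : M → ℝ := fun x ↦ LinearMap.trace ℝ (TangentSpace 𝓘(ℝ, E) x) (S.l x)
  have hf (x : M) : MDifferentiableAt 𝓘(ℝ, E) 𝓘(ℝ, ℝ) f x ∧ mfderiv 𝓘(ℝ, E) 𝓘(ℝ, ℝ) f x = 0 := by
    obtain ⟨U, X, hx, h, p, μ, τ, α, β, H⟩ := hframe x
    exact h.mfderiv_eq_zero (fun u ↦ trace_l h H u) (D_trace_l hQ h H) ⟨x, hx⟩
  obtain ⟨x₀⟩ := (inferInstance : Nonempty M)
  have hconst (x : M) : f x = 2 * (f x₀ / 2) := by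
    have hloc := isLocallyConstant_of_mfderiv_eq_zero (fun x ↦ (hf x).1) fun x ↦ (hf x).2
    rw [hloc.apply_eq_of_isPreconnected isPreconnected_univ (Set.mem_univ x) (Set.mem_univ x₀)]
    ring
  generalize f x₀ / 2 = k at hconst
  have hR (hk : k ≠ -1) (x : M) : ∃ (U : Set M) (X : ∀ x : M, TangentSpace 𝓘(ℝ, E) x) (hx : x ∈ U)
      (h : IsOrthonormalFrame S.g U (S.frame X) ![1, 1, -1]), h.HasConstR ⟨x, hx⟩ k := by
    obtain ⟨U, X, hx, h, p, μ, τ, α, β, H⟩ := hframe x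
    exact ⟨U, X, hx, h, hasConstR hQ h H (fun u ↦ (trace_l h H u).symm.trans (hconst u)) hk _⟩
  refine ⟨k, hconst, ?_⟩
  by_cases hk : k = -1
  · refine Or.inl ⟨hk, fun x ↦ ?_⟩
    obtain ⟨U, X, hx, h, p, μ, τ, α, β, H⟩ := hframe x
    -- In the frame tr h² = tr l + 2, and here tr l = -2.
    have e1 := (trace_l h H ⟨x, hx⟩).symm.trans (hconst x)
    refine (trace_h_sq h H ⟨x, hx⟩).trans ?_
    change 2 * (μ.1 ⟨x, hx⟩ * μ.1 ⟨x, hx⟩ - p.1 ⟨x, hx⟩ * p.1 ⟨x, hx⟩ - 1) = 2 * k at e1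
    change 2 * (μ.1 ⟨x, hx⟩ * μ.1 ⟨x, hx⟩ - p.1 ⟨x, hx⟩ * p.1 ⟨x, hx⟩) = 0
    linarith
  by_cases hk0 : k = 0
  · refine Or.inr (Or.inl ⟨hk0, fun x v w z ↦ ?_⟩)
    obtain ⟨U, X, hx, h, H⟩ := hR hk x
    exact (hk0 ▸ H).curvature_eq_zero v w z
  refine Or.inr (Or.inr ⟨hk, hk0, fun e ↦ hk (by linarith), fun x v hv hv' ↦ ?_,
    fun x v hv hv' ↦ ?_, fun x ↦ ?_⟩) <;> obtain ⟨U, X, hx, h, H⟩ := hR hk x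
  · exact sectionalCurvature_ξ H hv hv'
  · exact sectionalCurvature_φ H hv hv'
  · exact H.scal_eq
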